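/- Let $\mathcal H^{\rm fin}$ be the bosonic Fock space of finite particle vectors, spanned by the orthonormal occupation number states $|\nu\rangle$ ($\nu$ a finitely supported function from $\{1,2,\dots\}$ to $\mathbb N$), and $\mathcal H$ its Hilbert space completion. For $\beta\in\mathbb R$ let $\mathcal H_\beta^{\rm fin}\subset\mathcal H_\beta$ be a copy of it on which the $\mathrm U(1)$-current acts by $J_n$ ($n\in\mathbb Z$): for $n>0$, $J_{-n}|\nu\rangle=\sqrt{n(\nu_n+1)}\,|\nu+\delta_n\rangle$, $J_n|\nu\rangle=\sqrt{n\nu_n}\,|\nu-\delta_n\rangle$, and $J_0=\beta$ (so $[J_m,J_n]=m\,\delta_{m,-n}$, $J_n^*=J_{-n}$, and the lowest weight vector is $\Omega_\beta=|0\rangle$). Let $L_{\beta,n}=\frac12\sum_k :J_{n-k}J_k:$ be the Sugawara operators. For $\alpha\in\mathbb R$ put $d=\alpha^2/2$ and $$Y_\alpha(z)=c_\alpha E^-(\alpha,z)E^+(\alpha,z)z^{\alpha J_0}=\sum_{s\in\mathbb R}Y_{\alpha,s}z^{-s-d},\qquad E^\pm(\alpha,z)=\exp\Bigl(\mp\sum_{n>0}\frac{\alpha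 J_{\pm n}}{n}z^{\mp n}\Bigr),$$ where $c_\alpha:\mathcal H_\beta\to\mathcal H_{\beta+\alpha}$ is the identification of the two copies of Fock space and $z^{\alpha J_0}=z^{\alpha\beta}$ on $\mathcal H_\beta$. Let $\alpha_0\in\mathbb R$, $0<|\alpha_0|\le 1$, and $\alpha\in\alpha_0\mathbb Z$ with $|\alpha|<\frac1{\sqrt2}$, and let $\lambda\in\mathbb C$. On the Hilbert space $\widetilde{\mathcal H}=\bigoplus_{j\in\mathbb Z}\mathcal H_{j\alpha_0}\otimes\mathcal H_{j\alpha_0}$ consider the subspace $\mathcal D=\bigoplus_{j,\mathrm{alg}}\mathcal H^{\rm fin}_{j\alpha_0}\otimes_{\rm alg}\mathcal H^{\rm fin}_{j\alpha_0}$, let $\hat L_n=\bigoplus_j L_{j\alpha_0,n}$, and consider the operators $$\mathfrak l_0=\hat L_0\otimes 1-1\otimes\hat L_0,\qquad \mathfrak l_m=\hat L_m\otimes 1+1\otimes\hat L_{-m}+\lambda\sum_{k\in\mathbb R,\ \epsilon=\pm1}Y_{\epsilon\alpha,k}\otimes Y_{\epsilon\alpha,-m+k}\quad(m\in\mathbb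 Z\setminus\{0\}),$$ defined on those vectors of $\mathcal D$ on which the series converges unconditionally. Then $\mathcal D$ is dense, on each $\mathcal H_{j\alpha_0}^{\rm fin}\otimes_{\rm alg}\mathcal H_{j\alpha_0}^{\rm fin}$ only countably many terms of the series are nonzero, and the Lorentz relations $[\mathfrak l_m,\mathfrak l_n]=(m-n)\mathfrak l_{m+n}$, $m,n\in\{-1,0,1\}$, are weakly satisfied on $\mathcal D$. That is, $\mathcal D$ is contained in the domain of $\mathfrak l_m$ for $|m|\le 2$ and of $\mathfrak l_m^*$ for $|m|\le 1$, and for all $m,n\in\{-1,0,1\}$ and $\Psi_1,\Psi_2\in\mathcal D$ $$\langle \mathfrak l_m^*\Psi_1,\mathfrak l_n\Psi_2\rangle-\langle \mathfrak l_n^*\Psi_1,\mathfrak l_m\Psi_2\rangle=(m-n)\langle\Psi_1,\mathfrak l_{m+n}\Psi_2\rangle,$$ where the right-hand side is $0$ if $m=n$. -/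

import Mathlib

noncomputable section

namespace ChargedU1

open scoped TensorProduct

/-! ## The Fock space of the U(1)-current -/

/-- Occupation numbers: `ν n` is the number of particles in the mode `n > 0`. -/
abbrev Occ : Type := ℕ+ →₀ ℕ

/-- The space of finite vectors of one charged sector: finite linear combinations of the
occupation number states `|ν⟩`. The sectors of all charges `β` are realized on this same space,
the lowest weight vector `Ω_β` being `|0⟩`. -/
def SecFin : Type := Occ →₀ ℂ

instance : AddCommGroup SecFin := inferInstanceAs (AddCommGroup (Occ →₀ ℂ))

instance : Module ℂ SecFin := inferInstanceAs (Module ℂ (Occ →₀ ℂ))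

/-- The basis of occupation number states. -/
def fockBasis : Module.Basis Occ ℂ SecFin := .ofRepr (LinearEquiv.refl ℂ (Occ →₀ ℂ))

/-- The occupation number state `|ν⟩`. -/
abbrev ket (ν : Occ) : SecFin := fockBasis ν

/-- The Hilbert space of one charged sector: the states `|ν⟩` form an orthonormal basis. -/
abbrev SecHil : Type := lp (fun _ : Occ => ℂ) 2

/-- The inclusion of the finite vectors in the Hilbert space. -/
def embed0 : SecFin →ₗ[ℂ] SecHil :=
  fockBasis.constr ℂ fun ν => lp.single 2 ν (1 : ℂ)

/-- Creation operator `J_{-n}`, `n > 0`: `|ν⟩ ↦ √(n (ν_n + 1)) |ν + δ_n⟩`. -/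
def create (n : ℕ+) : Module.End ℂ SecFin :=
  fockBasis.constr ℂ fun ν =>
    ((Real.sqrt ((n : ℝ) * ((ν n : ℝ) + 1)) : ℝ) : ℂ) • ket (ν + Finsupp.single n 1)

/-- Annihilation operator `J_n`, `n > 0`: `|ν⟩ ↦ √(n ν_n) |ν - δ_n⟩`, which is `0` if `ν_n = 0`. -/
def annihilate (n : ℕ+) : Module.End ℂ SecFin :=
  fockBasis.constr ℂ fun ν =>
    ((Real.sqrt ((n : ℝ) * (ν n : ℝ)) : ℝ) : ℂ) • ket (ν - Finsupp.single n 1)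

/-- The Fourier coefficients `J_{β,n}` of the current in the sector of charge `β`;
`J_{β,0}` is the scalar `β`. -/
def J (β : ℝ) : ℤ → Module.End ℂ SecFin
  | .ofNat 0 => (β : ℂ) • 1
  | .ofNat (k + 1) => annihilate k.succPNat
  | .negSucc k => create k.succPNat

/-- The operator `∑ i, A i` on finite vectors, for a family of which only finitely many members
do not annihilate a given basis vector. -/
def opSum {ι : Type*} (A : ι → Module.End ℂ SecFin) : Module.End ℂ SecFin :=
  fockBasis.constr ℂ fun ν => ∑ᶠ i, A i (ket ν)

/-- The normally ordered product `:J_a J_b:` (the larger index stands to the right). -/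
def normalOrdered (β : ℝ) (a b : ℤ) : Module.End ℂ SecFin :=
  if a ≤ b then J β a * J β b else J β b * J β a

/-- The Sugawara operators `L_{β,n} = ½ ∑ₖ :J_{n-k} J_k:` in the sector of charge `β`. -/
def L (β : ℝ) (n : ℤ) : Module.End ℂ SecFin :=
  (1 / 2 : ℂ) • opSum fun k : ℤ => normalOrdered β (n - k) k

/-! ## Charged fields -/

/-- The coefficient of `t ^ k` in the formal series `exp (∑_{n > 0} a n t ^ n)`. The powers `r > k`
of the exponent do not contribute to it. -/
def expCoeff (a : ℕ → Module.End ℂ SecFin) (k : ℕ) : Module.End ℂ SecFin :=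
  ∑ r ∈ Finset.range (k + 1), ((r.factorial : ℂ)⁻¹) •
    PowerSeries.coeff k ((PowerSeries.mk fun n => if n = 0 then 0 else a n) ^ r)

/-- The coefficient of `z ^ (-k)` in `E⁺(α, z) = exp (- ∑_{n > 0} (α / n) J_n z ^ (-n))`. -/
def Eplus (α : ℝ) (k : ℕ) : Module.End ℂ SecFin :=
  expCoeff (fun n => (-((α : ℂ) / (n : ℂ))) • J 0 (n : ℤ)) k

/-- The coefficient of `z ^ k` in `E⁻(α, z) = exp (∑_{n > 0} (α / n) J_{-n} z ^ n)`. -/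
def Eminus (α : ℝ) (k : ℕ) : Module.End ℂ SecFin :=
  expCoeff (fun n => ((α : ℂ) / (n : ℂ)) • J 0 (-(n : ℤ))) k

open Classical in
/-- The coefficient `Y_{α,s}`, `s ∈ ℝ`, of the charged field
`Y_α(z) = c_α E⁻(α, z) E⁺(α, z) z ^ (α J₀) = ∑ₛ Y_{α,s} z ^ (-s-d)`, `d = α² / 2`,
as a map from the sector of charge `β` to the sector of charge `β + α`. As all sectors are
realized on the same space, the charge shift `c_α` is the identity here; the
terms `E⁻_p E⁺_q z ^ (p - q + α β)` with `p - q + α β = -s - d` are collected. -/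
def Y (α β s : ℝ) : Module.End ℂ SecFin :=
  opSum fun pq : ℕ × ℕ =>
    if (pq.1 : ℝ) - (pq.2 : ℝ) + α * β = -s - α ^ 2 / 2 then Eminus α pq.1 * Eplus α pq.2 else 0

/-! ## The two-dimensional Hilbert space and the domain of finite vectors -/

/-- The Hilbert space tensor product of two sectors. -/
abbrev TwoSec : Type := UniformSpace.Completion (SecHil ⊗[ℂ] SecHil)

/-- The Hilbert space `⨁_{j ∈ ℤ} H_{jα₀} ⊗ H_{jα₀}` (completed tensor products and
Hilbert space direct sum). -/
abbrev TwoHil : Type := lp (fun _ : ℤ => TwoSec) 2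

/-- The algebraic direct sum over `j ∈ ℤ` of the algebraic tensor products of the spaces
of finite vectors of charge `j α₀`. -/
abbrev TwoFin : Type := ℤ →₀ (SecFin ⊗[ℂ] SecFin)

/-- The inclusion of one summand of `TwoFin` in the Hilbert space tensor product. -/
def embedTensor : (SecFin ⊗[ℂ] SecFin) →ₗ[ℂ] TwoSec :=
  (UniformSpace.Completion.toComplₗᵢ (𝕜 := ℂ) (E := SecHil ⊗[ℂ] SecHil)).toLinearMap ∘ₗ
    TensorProduct.map embed0 embed0

/-- The inclusion of the algebraic direct sum in the Hilbert space. -/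
def embed : TwoFin →ₗ[ℂ] TwoHil :=
  Finsupp.lsum ℂ fun j : ℤ =>
    lp.lsingle (𝕜 := ℂ) (E := fun _ : ℤ => TwoSec) 2 j ∘ₗ embedTensor

theorem embed0_apply (v : SecFin) (ν : Occ) : embed0 v ν = fockBasis.repr v ν := by
  classical
  obtain ⟨f, rfl⟩ := fockBasis.repr.symm.surjective v
  rw [LinearEquiv.apply_symm_apply]
  induction f using Finsupp.induction_linear with
  | zero => simp
  | add f g hf hg => rw [map_add, map_add, lp.coeFn_add, Pi.add_apply, hf, hg, Finsupp.add_apply]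
  | single i c =>
    simp [embed0, Pi.single_apply, Finsupp.single_apply, eq_comm]

theorem embed0_injective : Function.Injective embed0 := fun v w h => by
  refine fockBasis.ext_elem fun ν => ?_
  rw [← embed0_apply v, ← embed0_apply w, h]

theorem embedTensor_injective : Function.Injective embedTensor :=
  (UniformSpace.Completion.toComplₗᵢ (𝕜 := ℂ) (E := SecHil ⊗[ℂ] SecHil)).injective.comp
    (TensorProduct.map_injective_of_flat_flat _ _ embed0_injective embed0_injective)

theorem embed_apply (v : TwoFin) (j : ℤ) : embed v j = embedTensor (v j) := by
  induction v using Finsupp.induction_linear with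
  | zero => simp
  | add f g hf hg => rw [map_add, lp.coeFn_add, Pi.add_apply, hf, hg, Finsupp.add_apply, map_add]
  | single a b =>
    rcases eq_or_ne j a with rfl | h
    · simp [embed]
    · simp [embed, h]

theorem embed_injective : Function.Injective embed := fun v w h => by
  refine Finsupp.ext fun j => embedTensor_injective ?_
  rw [← embed_apply v, ← embed_apply w, h]

/-- The domain of finite vectors, as a subspace of the Hilbert space. -/
def finDomain : Submodule ℂ TwoHil := LinearMap.range embed

/-- The finite vectors in the Hilbert space, identified with the algebraic direct sum. -/
def finEquiv : TwoFin ≃ₗ[ℂ] finDomain := LinearEquiv.ofInjective embed embed_injective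

/-- The linear map of a subspace `D` of `E` to `E`, as an operator in `E` with domain `D`. -/
def opOn {E : Type*} [NormedAddCommGroup E] [NormedSpace ℂ E] (D : Submodule ℂ E)
    (B : D →ₗ[ℂ] E) : E →ₗ.[ℂ] E where
  domain := D
  toFun := B

/-- The operator `∑ k, B k` in `E`, defined on those vectors of `D` on which the series converges
(unconditionally) in `E`. -/
def seriesOn {E : Type*} [NormedAddCommGroup E] [NormedSpace ℂ E] (D : Submodule ℂ E)
    {κ : Type*} (B : κ → D →ₗ[ℂ] E) : E →ₗ.[ℂ] E where
  domain :=
    { carrier := {Ψ | ∃ h : Ψ ∈ D, Summable fun k => B k ⟨Ψ, h⟩}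
      zero_mem' := ⟨D.zero_mem, by
        have h0 : (⟨0, D.zero_mem⟩ : D) = 0 := rfl
        simpa only [h0, map_zero] using summable_zero⟩
      add_mem' := by
        rintro a b ⟨ha, sa⟩ ⟨hb, sb⟩
        refine ⟨D.add_mem ha hb, (sa.add sb).congr fun k => ?_⟩
        rw [← map_add]
        rfl
      smul_mem' := by
        rintro c a ⟨ha, sa⟩
        refine ⟨D.smul_mem c ha, (sa.const_smul c).congr fun k => ?_⟩
        rw [← map_smul]
        rfl }
  toFun :=
    { toFun := fun x => ∑' k, B k ⟨x.1, x.2.fst⟩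
      map_add' := by
        rintro ⟨a, ha, sa⟩ ⟨b, hb, sb⟩
        rw [← sa.tsum_add sb]
        refine tsum_congr fun k => ?_
        rw [← map_add]
        rfl
      map_smul' := by
        rintro c ⟨a, ha, sa⟩
        rw [RingHom.id_apply, ← sa.tsum_const_smul c]
        refine tsum_congr fun k => ?_
        rw [← map_smul]
        rfl }

/-- A linear map of finite vectors, as a map from `finDomain` to the Hilbert space. -/
def onFinDomain (A : TwoFin →ₗ[ℂ] TwoFin) : finDomain →ₗ[ℂ] TwoHil :=
  embed ∘ₗ A ∘ₗ finEquiv.symm.toLinearMap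

/-- The operator with domain `finDomain` given by a linear map of finite vectors. -/
def finOp (A : TwoFin →ₗ[ℂ] TwoFin) : TwoHil →ₗ.[ℂ] TwoHil :=
  opOn finDomain (onFinDomain A)

/-- The operator `∑ k, A k`, defined on those finite vectors on which the
series converges in the Hilbert space. -/
def seriesOp {κ : Type*} (A : κ → TwoFin →ₗ[ℂ] TwoFin) : TwoHil →ₗ.[ℂ] TwoHil :=
  seriesOn finDomain fun k => onFinDomain (A k)

/-! ## The Lorentz generators -/

/-- `L̂_m ⊗ 1` on finite vectors. -/
def LLeft (α₀ : ℝ) (m : ℤ) : TwoFin →ₗ[ℂ] TwoFin :=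
  Finsupp.lsum ℂ fun j : ℤ =>
    Finsupp.lsingle j ∘ₗ TensorProduct.map (L ((j : ℝ) * α₀) m) LinearMap.id

/-- `1 ⊗ L̂_m` on finite vectors. -/
def LRight (α₀ : ℝ) (m : ℤ) : TwoFin →ₗ[ℂ] TwoFin :=
  Finsupp.lsum ℂ fun j : ℤ =>
    Finsupp.lsingle j ∘ₗ TensorProduct.map LinearMap.id (L ((j : ℝ) * α₀) m)

/-- `Y_{α,s} ⊗ Y_{α,t}` on finite vectors, where `α = q α₀`; it maps the summand with
index `j` to the one with index `j + q`. -/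
def YY (α₀ : ℝ) (q : ℤ) (s t : ℝ) : TwoFin →ₗ[ℂ] TwoFin :=
  Finsupp.lsum ℂ fun j : ℤ =>
    Finsupp.lsingle (j + q) ∘ₗ
      TensorProduct.map (Y ((q : ℝ) * α₀) ((j : ℝ) * α₀) s) (Y ((q : ℝ) * α₀) ((j : ℝ) * α₀) t)

/-- The term `Y_{εα,k} ⊗ Y_{εα,-n+k}` for `k ∈ ℝ`, `ε = ±1`, where `α = q α₀`. -/
def modeTerm (α₀ : ℝ) (q n : ℤ) (p : ℝ × ℤˣ) : TwoFin →ₗ[ℂ] TwoFin :=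
  YY α₀ ((p.2 : ℤ) * q) p.1 (-(n : ℝ) + p.1)

/-- The coefficient of `z ^ (-n)` of the time-zero symmetrized charged field,
`∑_{k ∈ ℝ, ε = ±1} Y_{εα,k} ⊗ Y_{εα,-n+k}`, where `α = q α₀`. -/
def timeZeroMode (α₀ : ℝ) (q n : ℤ) : TwoHil →ₗ.[ℂ] TwoHil :=
  seriesOp (modeTerm α₀ q n)

/-- The generators: `L̂₀ ⊗ 1 - 1 ⊗ L̂₀` for `m = 0`, and
`L̂_m ⊗ 1 + 1 ⊗ L̂_{-m} + lam ∑_{k, ε} Y_{εα,k} ⊗ Y_{εα,-m+k}` for `m ≠ 0`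
(of interest for `m = ±1`). -/
def lorentzGen (α₀ : ℝ) (q : ℤ) (lam : ℂ) (m : ℤ) : TwoHil →ₗ.[ℂ] TwoHil :=
  if m = 0 then finOp (LLeft α₀ 0 - LRight α₀ 0)
  else finOp (LLeft α₀ m + LRight α₀ (-m)) + lam • timeZeroMode α₀ q m

/-- The relation `[A, B] = C` holds weakly on `D`: `D` is contained in the domains of
`A, A*, B, B*, C` and `⟨A* Ψ₁, B Ψ₂⟩ - ⟨B* Ψ₁, A Ψ₂⟩ = ⟨Ψ₁, C Ψ₂⟩` for `Ψ₁, Ψ₂ ∈ D`. -/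
def WeakCommutator (D : Submodule ℂ TwoHil) (A B C : TwoHil →ₗ.[ℂ] TwoHil) : Prop :=
  ∃ (hA : D ≤ A.domain) (hA' : D ≤ A.adjoint.domain) (hB : D ≤ B.domain)
    (hB' : D ≤ B.adjoint.domain) (hC : D ≤ C.domain), ∀ Ψ₁ Ψ₂ : D,
    inner ℂ (A.adjoint ⟨Ψ₁, hA' Ψ₁.2⟩) (B ⟨Ψ₂, hB Ψ₂.2⟩) -
        inner ℂ (B.adjoint ⟨Ψ₁, hB' Ψ₁.2⟩) (A ⟨Ψ₂, hA Ψ₂.2⟩) =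
      inner ℂ (Ψ₁ : TwoHil) (C ⟨Ψ₂, hC Ψ₂.2⟩)

end ChargedU1

end

noncomputable section

namespace ChargedU1

open scoped TensorProduct ComplexConjugate

/-! ## Finite vectors and adjoint pairs -/

/-! On the sector of charge β the mode Y_{α,s} vanishes unless s = -α²/2 - αβ - N with N an integer,
and then it is V_N, the coefficient of z^N in E⁻(α,z)E⁺(α,z) (`Y_eq_zero`, `Y_eq_V`). The
interaction is therefore a sum of V_N ⊗ V_{N+n} over integers N and over both signs of the charge.

Convergence: V_N raises the energy by N, so on a product of occupation number states the terms for
different N are orthogonal and only their norms matter. Normal ordering, E⁺(α,z)E⁻(α',w) = (1 -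
w/z)^{αα'} E⁻(α',w)E⁺(α,z) (`Ep_mul_Em`), turns inner products of V_N|ν⟩ and V_{N+e}|ν'⟩ into finite
combinations, with weights independent of N, of Taylor coefficients of (1 - x)^γ, γ = -α₁α₂, at
places shifted by N (`inner_V_V`). These coefficients are square summable for γ > -1/2
(`summable_binom_sq`), which is ensured by α² < 1/2.

Adjoints: V_N of charge α is formally adjoint to V_{-N} of charge -α. As both signs of α are summed,
the adjoint of 𝔩_m with coupling λ acts on 𝒟 as 𝔩_{-m} with the conjugate coupling
(`inner_gen_embed`). The weak commutators thereby become polynomial identities in λ between inner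
products.

At order zero these are the sl(2) relations of the Sugawara operators. At order one they express
that the charged field is primary: V_N ⊗ V_{N+n} changes the eigenvalue of 𝔩₀ by -n, and the two
mixed contributions to [𝔩₁, 𝔩₋₁] agree after shifts of N (`inner_freeGen_productMode_swap`). Order
two is locality at time zero: the sum over N produces the autocorrelation of the coefficients of (1
- x)^γ, the exchange of the two fields reverses the sign of its argument, and it is even
(`corr_neg`, `tsum_inner_V_V_swap`). -/

theorem ket_induction {P : SecFin → Prop} (x : SecFin) (zero : P 0)
    (add : ∀ x y, P x → P y → P (x + y)) (smul : ∀ (c : ℂ) x, P x → P (c • x))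
    (ket : ∀ ν, P (ket ν)) : P x := by
  induction fockBasis.mem_span x using Submodule.span_induction with
  | mem x h => obtain ⟨ν, rfl⟩ := h; exact ket ν
  | zero => exact zero
  | add x y _ _ hx hy => exact add x y hx hy
  | smul c x _ hx => exact smul c x hx

theorem embed0_ket (ν : Occ) : embed0 (ket ν) = lp.single 2 ν (1 : ℂ) := by
  simp [embed0]

theorem inner_ket_ket (ν μ : Occ) :
    inner ℂ (embed0 (ket ν)) (embed0 (ket μ)) = if ν = μ then 1 else 0 := by
  rw [embed0_ket, embed0_ket, lp.inner_single_left]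
  simp [Pi.single_apply]

/-- `B` is a formal adjoint of `A` on the finite vectors. -/
def IsAdj (A B : Module.End ℂ SecFin) : Prop :=
  ∀ x y, inner ℂ (embed0 (A x)) (embed0 y) = inner ℂ (embed0 x) (embed0 (B y))

theorem isAdj_of_ket {A B : Module.End ℂ SecFin}
    (h : ∀ ν μ, inner ℂ (embed0 (A (ket ν))) (embed0 (ket μ)) =
      inner ℂ (embed0 (ket ν)) (embed0 (B (ket μ)))) : IsAdj A B := by
  intro x y
  induction x using ket_induction with
  | zero => simp
  | add x x' hx hx' => simp only [map_add, inner_add_left, hx, hx']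
  | smul c x hx => simp only [map_smul, inner_smul_left, hx]
  | ket ν =>
    induction y using ket_induction with
    | zero => simp
    | add x x' hx hx' => simp only [map_add, inner_add_right, hx, hx']
    | smul c x hx => simp only [map_smul, inner_smul_right, hx]
    | ket μ => exact h ν μ

namespace IsAdj

variable {A B A' B' : Module.End ℂ SecFin}

theorem symm (h : IsAdj A B) : IsAdj B A := fun x y => by
  rw [← inner_conj_symm, ← h y x, inner_conj_symm]

theorem add (h : IsAdj A B) (h' : IsAdj A' B') : IsAdj (A + A') (B + B') := fun x y => by
  simp only [LinearMap.add_apply, map_add, inner_add_left, inner_add_right, h x y, h' x y]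

theorem sub (h : IsAdj A B) (h' : IsAdj A' B') : IsAdj (A - A') (B - B') := fun x y => by
  simp only [LinearMap.sub_apply, map_sub, inner_sub_left, inner_sub_right, h x y, h' x y]

theorem mul (h : IsAdj A B) (h' : IsAdj A' B') : IsAdj (A * A') (B' * B) := fun x y => by
  simp only [Module.End.mul_apply, h _ _, h' _ _]

theorem smul (c : ℂ) (h : IsAdj A B) : IsAdj (c • A) (conj c • B) := fun x y => by
  simp only [LinearMap.smul_apply, map_smul, inner_smul_left, inner_smul_right, h x y]

theorem smul_of_conj_eq {c : ℂ} (hc : conj c = c) (h : IsAdj A B) : IsAdj (c • A) (c • B) := by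
  simpa only [hc] using h.smul c

theorem zero : IsAdj 0 0 := fun x y => by simp

theorem one : IsAdj 1 1 := fun x y => by simp

theorem sum {ι : Type*} (s : Finset ι) {A B : ι → Module.End ℂ SecFin}
    (h : ∀ i ∈ s, IsAdj (A i) (B i)) : IsAdj (∑ i ∈ s, A i) (∑ i ∈ s, B i) := fun x y => by
  simp only [LinearMap.sum_apply, map_sum, sum_inner, inner_sum]
  exact Finset.sum_congr rfl fun i hi => h i hi x y

/-- Formal adjoints are unique. -/
theorem unique (h : IsAdj A B) (h' : IsAdj A B') : B = B' := by
  ext y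
  apply embed0_injective
  have : embed0 (B y) - embed0 (B' y) = 0 := by
    rw [← map_sub, ← inner_self_eq_zero (𝕜 := ℂ)]
    rw [map_sub, inner_sub_right, ← map_sub, ← h, ← h', sub_self]
  exact sub_eq_zero.1 this

end IsAdj

/-! ## Locally finite sums of operators -/

/-- Only finitely many members of the family do not annihilate a given finite vector. -/
def LocFin {ι : Type*} (A : ι → Module.End ℂ SecFin) : Prop :=
  ∀ x, (Function.support fun i => A i x).Finite

section opSum

variable {ι : Type*} {A : ι → Module.End ℂ SecFin}

theorem locFin_of_ket (h : ∀ ν, (Function.support fun i => A i (ket ν)).Finite) : LocFin A := by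
  intro x
  induction x using ket_induction with
  | zero => simp [Function.support]
  | add x y hx hy =>
    refine (hx.union hy).subset ?_
    simp only [map_add]
    exact Function.support_add _ _
  | smul c x hx =>
    refine hx.subset ?_
    simp only [map_smul]
    exact Function.support_const_smul_subset c _
  | ket ν => exact h ν

/-- `opSum` is prescribed on the kets only. Local finiteness carries the formula to all finite
vectors, because `finsum` is additive only for finite supports. -/
theorem opSum_apply (h : LocFin A) (x : SecFin) : opSum A x = ∑ᶠ i, A i x := by
  induction x using ket_induction with
  | zero => simp
  | add x y hx hy => simp only [map_add, hx, hy, finsum_add_distrib (h x) (h y)]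
  | smul c x hx => simp only [map_smul, hx, smul_finsum' c (h x)]
  | ket ν => simp [opSum]

theorem opSum_apply_eq_sum (h : LocFin A) (x : SecFin) (s : Finset ι)
    (hs : ∀ i, i ∉ s → A i x = 0) : opSum A x = ∑ i ∈ s, A i x := by
  rw [opSum_apply h]
  exact finsum_eq_sum_of_support_subset _ fun i hi => by
    by_contra hi'; exact hi (hs i hi')

theorem LocFin.isAdj {B : ι → Module.End ℂ SecFin} (hA : LocFin A) (hB : LocFin B)
    (h : ∀ i, IsAdj (A i) (B i)) : IsAdj (opSum A) (opSum B) := by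
  classical
  intro x y
  rw [opSum_apply_eq_sum hA x ((hA x).toFinset ∪ (hB y).toFinset),
    opSum_apply_eq_sum hB y ((hA x).toFinset ∪ (hB y).toFinset)]
  · simp only [map_sum, sum_inner, inner_sum]
    exact Finset.sum_congr rfl fun i _ => h i x y
  · intro i hi; simp at hi; exact hi.2
  · intro i hi; simp at hi; exact hi.1

theorem LocFin.comp {κ : Type*} (h : LocFin A) {e : κ → ι} (he : Function.Injective e) :
    LocFin fun k => A (e k) :=
  fun x => (h x).preimage he.injOn

theorem LocFin.add {B : ι → Module.End ℂ SecFin} (hA : LocFin A) (hB : LocFin B) :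
    LocFin fun i => A i + B i :=
  fun x => ((hA x).union (hB x)).subset (Function.support_add _ _)

theorem LocFin.smul (hA : LocFin A) (c : ι → ℂ) : LocFin fun i => c i • A i :=
  fun x => (hA x).subset fun i hi h => hi (by simp [h])

theorem LocFin.mul_left (hA : LocFin A) (X : ι → Module.End ℂ SecFin) :
    LocFin fun i => X i * A i :=
  fun x => (hA x).subset fun i hi h => hi (by simp [h])

theorem LocFin.mul_right (hA : LocFin A) (X : Module.End ℂ SecFin) :
    LocFin fun i => A i * X :=
  fun x => hA (X x)

theorem opSum_add {B : ι → Module.End ℂ SecFin} (hA : LocFin A) (hB : LocFin B) :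
    opSum (fun i => A i + B i) = opSum A + opSum B := by
  ext x
  rw [LinearMap.add_apply, opSum_apply hA, opSum_apply hB, opSum_apply (hA.add hB)]
  exact finsum_add_distrib (hA x) (hB x)

theorem opSum_smul (hA : LocFin A) (c : ℂ) : opSum (fun i => c • A i) = c • opSum A := by
  ext x
  rw [LinearMap.smul_apply, opSum_apply hA, opSum_apply (hA.smul _), smul_finsum' c (hA x)]
  rfl

theorem mul_opSum (hA : LocFin A) (X : Module.End ℂ SecFin) :
    X * opSum A = opSum fun i => X * A i := by
  ext x
  rw [Module.End.mul_apply, opSum_apply hA, opSum_apply (hA.mul_left _)]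
  exact X.toAddMonoidHom.map_finsum (hA x)

theorem opSum_mul (hA : LocFin A) (X : Module.End ℂ SecFin) :
    opSum A * X = opSum fun i => A i * X := by
  ext x
  rw [Module.End.mul_apply, opSum_apply hA, opSum_apply (hA.mul_right _)]
  rfl

theorem opSum_equiv {κ : Type*} (h : LocFin A) (e : κ ≃ ι) :
    opSum (fun k => A (e k)) = opSum A := by
  ext x
  rw [opSum_apply h, opSum_apply (h.comp e.injective), ← finsum_comp_equiv e]

end opSum

/-! ## The current -/

theorem create_ket (n : ℕ+) (ν : Occ) : create n (ket ν) =
    ((Real.sqrt ((n : ℝ) * ((ν n : ℝ) + 1)) : ℝ) : ℂ) • ket (ν + Finsupp.single n 1) := by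
  simp [create]

theorem annihilate_ket (n : ℕ+) (ν : Occ) : annihilate n (ket ν) =
    ((Real.sqrt ((n : ℝ) * (ν n : ℝ)) : ℝ) : ℂ) • ket (ν - Finsupp.single n 1) := by
  simp [annihilate]

theorem isAdj_create (n : ℕ+) : IsAdj (create n) (annihilate n) := by
  refine isAdj_of_ket fun ν μ => ?_
  rw [create_ket, annihilate_ket, map_smul, map_smul, inner_smul_left, inner_smul_right,
    inner_ket_ket, inner_ket_ket, Complex.conj_ofReal]
  by_cases h : ν + Finsupp.single n 1 = μ
  · subst h
    simp
  · rw [if_neg h]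
    -- In an empty mode the truncated subtraction leaves `μ` unchanged, but its coefficient is the
    -- square root of zero.
    by_cases h0 : μ n = 0
    · simp [h0]
    · have h1 : ν ≠ μ - Finsupp.single n 1 := by
        rintro rfl
        apply h
        rw [tsub_add_cancel_iff_le]
        simpa [Nat.one_le_iff_ne_zero] using h0
      rw [if_neg h1, mul_zero, mul_zero]

theorem create_comm (m n : ℕ+) : create m * create n = create n * create m := by
  rcases eq_or_ne m n with rfl | h
  · rfl
  refine fockBasis.ext fun ν => ?_
  simp only [Module.End.mul_apply]
  rw [create_ket, create_ket, map_smul, map_smul, create_ket, create_ket, smul_smul, smul_smul,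
    add_right_comm, mul_comm]
  simp [h, h.symm]

/-- The adjoint of `create_comm`. Uniqueness of formal adjoints is used in this way throughout to
obtain relations without a second computation. -/
theorem annihilate_comm (m n : ℕ+) : annihilate m * annihilate n = annihilate n * annihilate m := by
  have h := (isAdj_create n).mul (isAdj_create m)
  rw [create_comm] at h
  exact h.unique ((isAdj_create m).mul (isAdj_create n))

theorem annihilate_mul_create (m n : ℕ+) :
    annihilate m * create n = create n * annihilate m + if m = n then (m : ℂ) • 1 else 0 := by
  refine fockBasis.ext fun ν => ?_
  simp only [Module.End.mul_apply, LinearMap.add_apply]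
  rw [create_ket, annihilate_ket, map_smul, map_smul, create_ket, annihilate_ket, smul_smul,
    smul_smul, ← Complex.ofReal_mul, ← Complex.ofReal_mul]
  have hm : (0 : ℝ) ≤ m := by positivity
  rcases eq_or_ne m n with rfl | h
  · rw [if_pos rfl, add_tsub_cancel_right, ← Real.sqrt_mul (by positivity)]
    have h1 : Real.sqrt ((m : ℝ) * (ν m + 1) *
        ((m : ℝ) * (((ν + Finsupp.single m 1 : Occ) m : ℕ) : ℝ))) = m * (ν m + 1) := by
      rw [Real.sqrt_eq_iff_mul_self_eq (by positivity) (by positivity)]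
      simp
    rw [h1]
    rcases Nat.eq_zero_or_pos (ν m) with h0 | h0
    · simp [h0]
    · have hle : Finsupp.single m 1 ≤ ν := by simpa [Nat.one_le_iff_ne_zero, Nat.pos_iff_ne_zero] using h0
      rw [tsub_add_cancel_of_le hle, ← Real.sqrt_mul (by positivity)]
      have h2 : Real.sqrt ((m : ℝ) * ν m *
          ((m : ℝ) * ((((ν - Finsupp.single m 1 : Occ) m : ℕ) : ℝ) + 1))) = m * ν m := by
        rw [Real.sqrt_eq_iff_mul_self_eq (by positivity) (by positivity)]
        have : (((ν - Finsupp.single m 1 : Occ) m : ℕ) : ℝ) + 1 = ν m := by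
          rw [Finsupp.tsub_apply, Finsupp.single_eq_same]
          exact_mod_cast Nat.sub_add_cancel h0
        rw [this]
      rw [h2, LinearMap.smul_apply, Module.End.one_apply, ← add_smul]
      congr 1
      push_cast
      ring
  · rw [if_neg h, LinearMap.zero_apply, add_zero]
    rcases Nat.eq_zero_or_pos (ν m) with h0 | h0
    · simp [h0, h]
    · have hle : Finsupp.single m 1 ≤ ν := by simpa [Nat.one_le_iff_ne_zero, Nat.pos_iff_ne_zero] using h0
      rw [tsub_add_eq_add_tsub hle, mul_comm]
      simp [h, h.symm]

theorem J_zero (β : ℝ) : J β 0 = (β : ℂ) • 1 := rfl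

theorem J_natCast (β : ℝ) (n : ℕ+) : J β ((n : ℕ) : ℤ) = annihilate n := by
  obtain ⟨k, rfl⟩ : ∃ k : ℕ, n = k.succPNat := ⟨n.natPred, by simp⟩
  rfl

theorem J_neg_natCast (β : ℝ) (n : ℕ+) : J β (-((n : ℕ) : ℤ)) = create n := by
  obtain ⟨k, rfl⟩ : ∃ k : ℕ, n = k.succPNat := ⟨n.natPred, by simp⟩
  rfl

theorem int_cases (m : ℤ) : m = 0 ∨ (∃ n : ℕ+, m = ((n : ℕ) : ℤ)) ∨ ∃ n : ℕ+, m = -((n : ℕ) : ℤ) := by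
  rcases lt_trichotomy m 0 with h | h | h
  · exact Or.inr (Or.inr ⟨⟨m.natAbs, by omega⟩, by rw [PNat.mk_coe]; omega⟩)
  · exact Or.inl h
  · exact Or.inr (Or.inl ⟨⟨m.natAbs, by omega⟩, by rw [PNat.mk_coe]; omega⟩)

/-- The charge enters only through the zero mode, so the exponentials can be built from `J 0` in
every sector. -/
theorem J_eq (β β' : ℝ) {n : ℤ} (hn : n ≠ 0) : J β n = J β' n := by
  rcases int_cases n with rfl | ⟨n, rfl⟩ | ⟨n, rfl⟩
  · exact absurd rfl hn
  · rw [J_natCast, J_natCast]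
  · rw [J_neg_natCast, J_neg_natCast]

theorem isAdj_J (β : ℝ) (n : ℤ) : IsAdj (J β n) (J β (-n)) := by
  rcases int_cases n with rfl | ⟨n, rfl⟩ | ⟨n, rfl⟩
  · exact IsAdj.one.smul_of_conj_eq (Complex.conj_ofReal β)
  · rw [J_natCast, J_neg_natCast]
    exact (isAdj_create n).symm
  · rw [neg_neg, J_natCast, J_neg_natCast]
    exact isAdj_create n

theorem J_mul_J (β : ℝ) (m n : ℤ) :
    J β m * J β n = J β n * J β m + if m = -n then (m : ℂ) • 1 else 0 := by
  rcases int_cases m with rfl | ⟨m, rfl⟩ | ⟨m, rfl⟩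
  · simp [J_zero]
  · rcases int_cases n with rfl | ⟨n, rfl⟩ | ⟨n, rfl⟩
    · simp [J_zero]
    · have : ((m : ℕ) : ℤ) ≠ -((n : ℕ) : ℤ) := by have := m.pos; omega
      rw [J_natCast, J_natCast, annihilate_comm, if_neg this, add_zero]
    · rw [J_natCast, J_neg_natCast, annihilate_mul_create]
      simp
  · rcases int_cases n with rfl | ⟨n, rfl⟩ | ⟨n, rfl⟩
    · simp [J_zero]
    · rw [J_natCast, J_neg_natCast, annihilate_mul_create]
      by_cases h : m = n
      · subst h; simp
      · have h' : n ≠ m := Ne.symm h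
        have : (m : ℕ) ≠ (n : ℕ) := fun hh => h (PNat.eq hh)
        simp [h', this]
    · have : (-(m : ℕ) : ℤ) ≠ - -((n : ℕ) : ℤ) := by have := m.pos; omega
      rw [J_neg_natCast, J_neg_natCast, create_comm, if_neg this, add_zero]

/-- An annihilation operator of a mode that is not occupied gives zero. -/
theorem J_ket_eq_zero (β : ℝ) (ν : Occ) {n : ℤ} (hn : 0 < n)
    (h : ∀ k ∈ ν.support, ((k : ℕ) : ℤ) < n) : J β n (ket ν) = 0 := by
  rcases int_cases n with rfl | ⟨n, rfl⟩ | ⟨n, rfl⟩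
  · omega
  · have : ν n = 0 := by
      by_contra h0
      exact lt_irrefl _ (h n (Finsupp.mem_support_iff.2 h0))
    rw [J_natCast, annihilate_ket, this]
    simp
  · omega

theorem exists_bound_J (ν : Occ) : ∃ M : ℕ, ∀ (β : ℝ) (n : ℤ), (M : ℤ) < n → J β n (ket ν) = 0 := by
  refine ⟨ν.support.sup fun k => (k : ℕ), fun β n hn => J_ket_eq_zero β ν (by omega) fun k hk => ?_⟩
  have : (k : ℕ) ≤ _ := Finset.le_sup (f := fun k : ℕ+ => (k : ℕ)) hk
  omega

theorem occ_induction {P : Occ → Prop} (ν : Occ) (zero : P 0)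
    (add : ∀ ν n, P ν → P (ν + Finsupp.single n 1)) : P ν := by
  induction ν using Finsupp.induction with
  | zero => exact zero
  | single_add a b f _ _ hf =>
    clear * - add hf
    induction b with
    | zero => simpa using hf
    | succ b ih =>
      rw [Finsupp.single_add, add_right_comm]
      exact add _ a ih

theorem ket_add_single (ν : Occ) (n : ℕ+) :
    ∃ c : ℂ, ket (ν + Finsupp.single n 1) = c • create n (ket ν) := by
  refine ⟨((Real.sqrt ((n : ℝ) * ((ν n : ℝ) + 1)) : ℝ) : ℂ)⁻¹, ?_⟩
  rw [create_ket, inv_smul_smul₀]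
  exact Complex.ofReal_ne_zero.2 (Real.sqrt_ne_zero'.2 (by positivity))

/-- The vacuum is cyclic for the creation operators. -/
theorem eq_zero_of_comm_create {X : Module.End ℂ SecFin} (h0 : X (ket 0) = 0)
    (h : ∀ n, X * create n = create n * X) : X = 0 := by
  refine fockBasis.ext fun ν => ?_
  rw [LinearMap.zero_apply]
  induction ν using occ_induction with
  | zero => exact h0
  | add ν n ih =>
    obtain ⟨c, hc⟩ := ket_add_single ν n
    have h1 := congrArg (fun A => A (ket ν)) (h n)
    simp only [Module.End.mul_apply] at h1
    change X (ket _) = 0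
    rw [hc, map_smul, h1, ih, map_zero, smul_zero]

theorem eq_zero_of_comm_J {X : Module.End ℂ SecFin} (h0 : X (ket 0) = 0)
    (h : ∀ n : ℤ, n < 0 → X * J 0 n = J 0 n * X) : X = 0 :=
  eq_zero_of_comm_create h0 fun n => by
    have := h (-((n : ℕ) : ℤ)) (by have := n.pos; omega)
    rwa [J_neg_natCast] at this

/-! ## The Sugawara operators -/

theorem J_mul_J_mul_J (β : ℝ) (a b m : ℤ) : J β a * J β b * J β m = J β m * (J β a * J β b) +
    ((if a = -m then (a : ℂ) • J β b else 0) + if b = -m then (b : ℂ) • J β a else 0) := by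
  rw [mul_assoc, J_mul_J β b m, mul_add, ← mul_assoc, J_mul_J β a m, add_mul, mul_assoc, add_assoc]
  congr 2
  · split_ifs <;> simp
  · split_ifs <;> simp

/-- The two orderings differ by a scalar, which the commutator with `J β m` does not see. -/
theorem normalOrdered_mul_J (β : ℝ) (a b m : ℤ) :
    normalOrdered β a b * J β m = J β m * normalOrdered β a b +
    ((if a = -m then (a : ℂ) • J β b else 0) + if b = -m then (b : ℂ) • J β a else 0) := by
  unfold normalOrdered
  split_ifs <;> simp only [J_mul_J_mul_J, *, if_true, if_false, add_comm]

theorem isAdj_normalOrdered (β : ℝ) (a b : ℤ) :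
    IsAdj (normalOrdered β a b) (normalOrdered β (-b) (-a)) := by
  unfold normalOrdered
  by_cases h : a ≤ b
  · rw [if_pos h, if_pos (by omega)]
    exact (isAdj_J β a).mul (isAdj_J β b)
  · rw [if_neg h, if_neg (by omega)]
    exact (isAdj_J β b).mul (isAdj_J β a)

theorem normalOrdered_apply_eq_zero {β : ℝ} {a b : ℤ} {x : SecFin} (h : J β (max a b) x = 0) :
    normalOrdered β a b x = 0 := by
  unfold normalOrdered
  split_ifs with hab
  · rw [max_eq_right hab] at h
    rw [Module.End.mul_apply, h, map_zero]
  · rw [max_eq_left (by omega)] at h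
    rw [Module.End.mul_apply, h, map_zero]

/-- The larger of `n - k` and `k` acts first, and it lies above all occupied modes unless `n - M ≤ k
≤ M`. -/
theorem locFin_normalOrdered (β : ℝ) (n : ℤ) :
    LocFin fun k : ℤ => normalOrdered β (n - k) k := by
  refine locFin_of_ket fun ν => ?_
  obtain ⟨M, hM⟩ := exists_bound_J ν
  refine (Set.finite_Icc (n - M) (M : ℤ)).subset fun k hk => ?_
  by_contra h
  refine hk (normalOrdered_apply_eq_zero (hM β _ ?_))
  rw [Set.mem_Icc] at h
  rw [lt_max_iff]
  omega

/-- The commutator of the Sugawara operators with the current. -/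
theorem L_mul_J (β : ℝ) (n m : ℤ) :
    L β n * J β m = J β m * L β n - (m : ℂ) • J β (m + n) := by
  classical
  ext x
  have hl := locFin_normalOrdered β n
  -- For `k = m + n` and `k = -m` one factor of the normally ordered product fails to commute with
  -- `J β m`. Each contributes -m J_{m+n}, which compensates the factor ½.
  set s := (hl x).toFinset ∪ (hl (J β m x)).toFinset ∪ {-m, m + n} with hs
  have h1 : opSum (fun k : ℤ => normalOrdered β (n - k) k) x =
      ∑ k ∈ s, normalOrdered β (n - k) k x :=
    opSum_apply_eq_sum hl x s fun i hi => by simp [hs] at hi; tauto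
  have h2 : opSum (fun k : ℤ => normalOrdered β (n - k) k) (J β m x) =
      ∑ k ∈ s, normalOrdered β (n - k) k (J β m x) :=
    opSum_apply_eq_sum hl _ s fun i hi => by simp [hs] at hi; tauto
  have h3 : ∀ k : ℤ, normalOrdered β (n - k) k (J β m x) = J β m (normalOrdered β (n - k) k x) +
      ((if k = m + n then (-(m : ℂ)) • J β (m + n) x else 0) +
        if k = -m then (-(m : ℂ)) • J β (m + n) x else 0) := by
    intro k
    have := congrArg (fun A => A x) (normalOrdered_mul_J β (n - k) k m)
    simp only [Module.End.mul_apply, LinearMap.add_apply] at this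
    rw [this]
    congr 2
    · by_cases h : k = m + n
      · rw [if_pos h, if_pos (by omega), h]
        have : n - (m + n) = -m := by ring
        rw [this]; simp
      · rw [if_neg h, if_neg (by omega), LinearMap.zero_apply]
    · by_cases h : k = -m
      · rw [if_pos h, if_pos h, h, sub_neg_eq_add, add_comm n m]; simp
      · rw [if_neg h, if_neg h, LinearMap.zero_apply]
  simp only [Module.End.mul_apply, L, LinearMap.smul_apply, LinearMap.sub_apply, map_smul]
  rw [h1, h2, Finset.sum_congr rfl fun k _ => h3 k, Finset.sum_add_distrib, Finset.sum_add_distrib,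
    Finset.sum_ite_eq', Finset.sum_ite_eq', if_pos (by simp [hs]), if_pos (by simp [hs]), map_sum]
  module

theorem isAdj_L (β : ℝ) (n : ℤ) : IsAdj (L β n) (L β (-n)) := by
  refine IsAdj.smul_of_conj_eq (by simp [Complex.conj_ofNat]) ?_
  have h := opSum_equiv (locFin_normalOrdered β (-n)) (Equiv.subRight n)
  rw [← h]
  refine (locFin_normalOrdered β n).isAdj
    ((locFin_normalOrdered β (-n)).comp (Equiv.subRight n).injective) fun k => ?_
  have := isAdj_normalOrdered β (n - k) k
  rwa [show -(n - k) = k - n by ring, show -k = -n - (k - n) by ring] at this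

theorem J_vacuum (β : ℝ) {n : ℤ} (hn : 0 < n) : J β n (ket 0) = 0 :=
  J_ket_eq_zero β 0 hn (by simp)

/-- For `n ≥ 0` and `k ≠ 0` one of `n - k`, `k` is positive, so only `k = 0` can survive on the
vacuum. -/
theorem L_vacuum_of_nonneg (β : ℝ) {n : ℤ} (hn : 0 ≤ n) :
    L β n (ket 0) = if n = 0 then ((β : ℂ) ^ 2 / 2) • ket 0 else 0 := by
  have h : ∀ k : ℤ, k ∉ ({0} : Finset ℤ) → normalOrdered β (n - k) k (ket 0) = 0 := fun k hk => by
    rw [Finset.mem_singleton] at hk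
    exact normalOrdered_apply_eq_zero (J_vacuum β (by rw [lt_max_iff]; omega))
  rw [L, LinearMap.smul_apply, opSum_apply_eq_sum (locFin_normalOrdered β n) _ {0} h,
    Finset.sum_singleton, sub_zero]
  split_ifs with h0
  · subst h0
    simp only [normalOrdered, le_refl, if_true, Module.End.mul_apply, J_zero, LinearMap.smul_apply,
      Module.End.one_apply]
    module
  · rw [normalOrdered_apply_eq_zero (J_vacuum β (by rw [lt_max_iff]; omega)), smul_zero]

theorem L_neg_one_vacuum (β : ℝ) : L β (-1) (ket 0) = (β : ℂ) • J β (-1) (ket 0) := by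
  have h : ∀ k : ℤ, k ∉ ({0, -1} : Finset ℤ) →
      normalOrdered β (-1 - k) k (ket 0) = 0 := fun k hk => by
    simp only [Finset.mem_insert, Finset.mem_singleton] at hk
    exact normalOrdered_apply_eq_zero (J_vacuum β (by rw [lt_max_iff]; omega))
  rw [L, LinearMap.smul_apply, opSum_apply_eq_sum (locFin_normalOrdered β (-1)) _ _ h,
    Finset.sum_pair (by decide)]
  norm_num [normalOrdered, J_zero]
  module

/-- The Witt relations between `L_{-1}`, `L_0` and `L_1`. -/
theorem L_mul_L (β : ℝ) {m n : ℤ} (h : L β m (L β n (ket 0)) =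
    L β n (L β m (ket 0)) + ((m : ℂ) - n) • L β (m + n) (ket 0)) :
    L β m * L β n = L β n * L β m + ((m : ℂ) - n) • L β (m + n) := by
  -- The commutator of either side with the current follows from `L_mul_J` alone and is the same for
  -- both. The difference thus commutes with all creation operators and vanishes if it kills the
  -- vacuum. The hypothesis on the vacuum excludes a central term.
  have hX : L β m * L β n - (L β n * L β m + ((m : ℂ) - n) • L β (m + n)) = 0 := by
    refine eq_zero_of_comm_J ?_ fun k hk => ?_
    · simp only [LinearMap.sub_apply, LinearMap.add_apply, Module.End.mul_apply,
        LinearMap.smul_apply, h, sub_self]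
    · rw [J_eq 0 β hk.ne]
      have e1 : L β m * L β n * J β k = J β k * (L β m * L β n) - (k : ℂ) • (J β (k + m) * L β n)
          - (k : ℂ) • (J β (k + n) * L β m - ((k + n : ℤ) : ℂ) • J β (k + n + m)) := by
        rw [mul_assoc, L_mul_J β n, mul_sub, ← mul_assoc, L_mul_J β m, mul_smul_comm, L_mul_J β m,
          sub_mul, mul_assoc, smul_mul_assoc]
      have e2 : L β n * L β m * J β k = J β k * (L β n * L β m) - (k : ℂ) • (J β (k + n) * L β m)
          - (k : ℂ) • (J β (k + m) * L β n - ((k + m : ℤ) : ℂ) • J β (k + n + m)) := by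
        rw [mul_assoc, L_mul_J β m, mul_sub, ← mul_assoc, L_mul_J β n, mul_smul_comm, L_mul_J β n,
          sub_mul, mul_assoc, smul_mul_assoc, add_right_comm k m n]
      have e3 : L β (m + n) * J β k = J β k * L β (m + n) - (k : ℂ) • J β (k + n + m) := by
        rw [L_mul_J, add_assoc, add_comm n m]
      rw [sub_mul, add_mul, e1, e2, smul_mul_assoc, e3, mul_sub, mul_add, mul_smul_comm]
      push_cast
      module
  exact sub_eq_zero.1 hX

/-! ### The sl(2) relations -/

theorem L_zero_mul_L_neg_one (β : ℝ) : L β 0 * L β (-1) = L β (-1) * L β 0 + L β (-1) := by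
  have h := L_mul_L β (m := 0) (n := -1) (by
    have hJ := congrArg (fun A => A (ket 0)) (L_mul_J β 0 (-1))
    simp only [Module.End.mul_apply, LinearMap.sub_apply, LinearMap.smul_apply] at hJ
    rw [zero_add, L_vacuum_of_nonneg β le_rfl, if_pos rfl, map_smul, L_neg_one_vacuum, map_smul, hJ,
      L_vacuum_of_nonneg β le_rfl, if_pos rfl, map_smul, add_zero]
    push_cast
    module)
  rw [h]; simp

theorem L_one_mul_L_neg_one (β : ℝ) :
    L β 1 * L β (-1) = L β (-1) * L β 1 + (2 : ℂ) • L β 0 := by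
  have h := L_mul_L β (m := 1) (n := -1) (by
    have hJ := congrArg (fun A => A (ket 0)) (L_mul_J β 1 (-1))
    simp only [Module.End.mul_apply, LinearMap.sub_apply, LinearMap.smul_apply] at hJ
    rw [L_vacuum_of_nonneg β zero_le_one, if_neg one_ne_zero, map_zero, L_neg_one_vacuum, map_smul,
      hJ, L_vacuum_of_nonneg β zero_le_one, if_neg one_ne_zero, map_zero, neg_add_cancel,
      add_neg_cancel, L_vacuum_of_nonneg β le_rfl, if_pos rfl, J_zero, LinearMap.smul_apply,
      Module.End.one_apply]
    push_cast
    module)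
  rw [h]; norm_num

theorem L_zero_mul_L_one (β : ℝ) : L β 0 * L β 1 = L β 1 * L β 0 - L β 1 := by
  have h := L_mul_L β (m := 0) (n := 1) (by
    simp [L_vacuum_of_nonneg β le_rfl, L_vacuum_of_nonneg β zero_le_one])
  rw [h]; simp [sub_eq_add_neg]

/-- The dependence of the Sugawara operators on the charge. -/
theorem L_eq_of_vacuum (β : ℝ) {n : ℤ} (c : ℂ)
    (h : L β n (ket 0) = L 0 n (ket 0) + ((β : ℂ) • J 0 n (ket 0) + c • ket 0)) :
    L β n = L 0 n + ((β : ℂ) • J 0 n + c • 1) := by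
  refine sub_eq_zero.1 (eq_zero_of_comm_J ?_ fun k hk => ?_)
  · simp only [LinearMap.sub_apply, LinearMap.add_apply, LinearMap.smul_apply, h,
      Module.End.one_apply, sub_self]
  · have h1 := L_mul_J β n k
    rw [J_eq β 0 hk.ne] at h1
    rw [sub_mul, add_mul, add_mul, h1, L_mul_J 0 n k, smul_mul_assoc, smul_mul_assoc, one_mul,
      J_mul_J 0 n k, mul_sub, mul_add, mul_add, mul_smul_comm, mul_smul_comm, mul_one]
    -- Only for `n = -k` does the commutator of `L β n` with the current involve the charge, through
    -- `J β 0`. The central term of β J_n supplies the same amount.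
    by_cases hkn : n = -k
    · subst hkn
      rw [if_pos rfl, add_neg_cancel, J_zero, J_zero]
      push_cast
      module
    · rw [if_neg hkn, J_eq β 0 (by omega)]
      module

theorem L_zero_eq (β : ℝ) : L β 0 = L 0 0 + ((β : ℂ) ^ 2 / 2) • 1 := by
  have h := L_eq_of_vacuum β (n := 0) ((β : ℂ) ^ 2 / 2) (by
    simp [L_vacuum_of_nonneg _ le_rfl, J_zero])
  rw [h, J_zero]; simp

theorem L_neg_one_eq (β : ℝ) : L β (-1) = L 0 (-1) + (β : ℂ) • J 0 (-1) := by
  have h := L_eq_of_vacuum β (n := -1) 0 (by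
    rw [L_neg_one_vacuum, L_neg_one_vacuum, J_eq β 0 (by decide)]; simp)
  rw [h]; simp

/-- The energy of an occupation number state. -/
def energy (ν : Occ) : ℕ := ν.sum fun n c => (n : ℕ) * c

theorem energy_add_single (ν : Occ) (n : ℕ+) :
    energy (ν + Finsupp.single n 1) = energy ν + n := by
  rw [energy, Finsupp.sum_add_index' (by simp) (by simp [mul_add]), Finsupp.sum_single_index (by simp),
    mul_one, energy]

theorem L_zero_ket (ν : Occ) : L 0 0 (ket ν) = (energy ν : ℂ) • ket ν := by
  induction ν using occ_induction with
  | zero => simp [L_vacuum_of_nonneg _ le_rfl, energy]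
  | add ν n ih =>
    obtain ⟨c, hc⟩ := ket_add_single ν n
    have hJ := congrArg (fun A => A (ket ν)) (L_mul_J 0 0 (-((n : ℕ) : ℤ)))
    simp only [Module.End.mul_apply, LinearMap.sub_apply, LinearMap.smul_apply, J_neg_natCast, ih,
      add_zero, map_smul] at hJ
    rw [hc, map_smul, hJ, energy_add_single]
    push_cast
    module

/-! ## Exponentials of commuting families -/

section expCoeff

variable {a : ℕ → Module.End ℂ SecFin}

/-- The exponent `∑_{n > 0} a n t ^ n`. -/
def expo (a : ℕ → Module.End ℂ SecFin) : PowerSeries (Module.End ℂ SecFin) :=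
  PowerSeries.mk fun n => if n = 0 then 0 else a n

/-- The exponent has no constant term. Hence the cutoff in `expCoeff` may be replaced by any larger
one. -/
theorem coeff_expo_pow_eq_zero {k r : ℕ} (h : k < r) : PowerSeries.coeff k (expo a ^ r) = 0 := by
  induction r generalizing k with
  | zero => omega
  | succ r ih =>
    rw [pow_succ, PowerSeries.coeff_mul]
    refine Finset.sum_eq_zero fun ij hij => ?_
    rw [Finset.HasAntidiagonal.mem_antidiagonal] at hij
    rcases Nat.eq_zero_or_pos ij.2 with h0 | h0
    · simp [expo, h0]
    · rw [ih (by omega), zero_mul]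

theorem expCoeff_eq_sum {k M : ℕ} (h : k < M) : expCoeff a k =
    ∑ r ∈ Finset.range M, ((r.factorial : ℂ)⁻¹) • PowerSeries.coeff k (expo a ^ r) := by
  refine Finset.sum_subset (by simpa using h) fun r _ hr => ?_
  rw [Finset.mem_range, not_lt] at hr
  change _ • PowerSeries.coeff k (expo a ^ r) = _
  rw [coeff_expo_pow_eq_zero (by omega), smul_zero]

/-- A family of linear maps `δ k` such that `∑ x k t ^ k ↦ ∑ δ k (x k) t ^ k` is a derivation
satisfies the chain rule for the exponential series. -/
theorem derivation_expCoeff (δ : ℕ → Module.End ℂ SecFin →ₗ[ℂ] Module.End ℂ SecFin)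
    (hδ : ∀ i j x y, δ (i + j) (x * y) = δ i x * y + x * δ j y)
    (hc : ∀ m n, 0 < m → 0 < n → Commute (δ m (a m)) (a n)) (k : ℕ) :
    δ k (expCoeff a k) = ∑ ij ∈ Finset.HasAntidiagonal.antidiagonal k,
      (if ij.1 = 0 then 0 else δ ij.1 (a ij.1)) * expCoeff a ij.2 := by
  let D : PowerSeries (Module.End ℂ SecFin) → PowerSeries (Module.End ℂ SecFin) :=
    fun f => PowerSeries.mk fun k => δ k (PowerSeries.coeff k f)
  have hD : ∀ f g, D (f * g) = D f * g + f * D g := fun f g => by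
    ext1 k
    simp only [D, PowerSeries.coeff_mk, PowerSeries.coeff_mul, map_add, map_sum]
    rw [← Finset.sum_add_distrib]
    refine Finset.sum_congr rfl fun ij hij => ?_
    rw [← Finset.HasAntidiagonal.mem_antidiagonal.1 hij, hδ]
  have hDA : D (expo a) = expo fun n => δ n (a n) := by
    ext1 k
    simp only [D, expo, PowerSeries.coeff_mk]
    split_ifs <;> simp
  have hcomm : D (expo a) * expo a = expo a * D (expo a) := by
    ext1 k
    rw [hDA, PowerSeries.coeff_mul, PowerSeries.coeff_mul, ← Finset.Nat.sum_antidiagonal_swap]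
    refine Finset.sum_congr rfl fun ij _ => ?_
    simp only [expo, PowerSeries.coeff_mk, Prod.fst_swap, Prod.snd_swap]
    split_ifs with h1 h2
    · simp
    · simp
    · simp
    · exact hc _ _ (Nat.pos_of_ne_zero h1) (Nat.pos_of_ne_zero ‹_›)
  have h1 : D 1 = 0 := by
    have := hD 1 1
    simpa using this
  -- As the derivative of the exponent commutes with the exponent, the power rule holds as in the
  -- commutative case.
  have hpow : ∀ r : ℕ, D (expo a ^ (r + 1)) = ((r : ℂ) + 1) • (D (expo a) * expo a ^ r) := by
    intro r
    induction r with
    | zero => simp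
    | succ r ih =>
      rw [pow_succ', hD, ih, mul_smul_comm, ← mul_assoc, ← hcomm, mul_assoc, ← pow_succ']
      push_cast
      module
  have key : ∀ r, δ k (PowerSeries.coeff k (expo a ^ r)) = PowerSeries.coeff k (D (expo a ^ r)) :=
    fun r => by simp [D]
  rw [expCoeff_eq_sum (Nat.lt_succ_self k), map_sum, Finset.sum_range_succ']
  simp only [map_smul, key]
  rw [pow_zero, h1, map_zero, smul_zero, add_zero]
  have h2 : ∀ r : ℕ, (((r + 1).factorial : ℂ)⁻¹) • PowerSeries.coeff k (D (expo a ^ (r + 1))) =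
      ∑ ij ∈ Finset.HasAntidiagonal.antidiagonal k, (if ij.1 = 0 then 0 else δ ij.1 (a ij.1)) *
        (((r.factorial : ℂ)⁻¹) • PowerSeries.coeff ij.2 (expo a ^ r)) := by
    intro r
    have hs : ∀ (c : ℂ) (f : PowerSeries (Module.End ℂ SecFin)),
        PowerSeries.coeff k (c • f) = c • PowerSeries.coeff k f := fun _ _ => rfl
    rw [hpow, hs, smul_smul, hDA, PowerSeries.coeff_mul, Finset.smul_sum]
    refine Finset.sum_congr rfl fun ij _ => ?_
    rw [mul_smul_comm, Nat.factorial_succ]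
    congr 1
    · have : ((r : ℂ) + 1) ≠ 0 := by exact_mod_cast Nat.succ_ne_zero r
      push_cast
      field_simp
    · simp [expo]
  rw [Finset.sum_congr rfl fun r _ => h2 r, Finset.sum_comm]
  refine Finset.sum_congr rfl fun ij hij => ?_
  rw [← Finset.mul_sum]
  rw [Finset.HasAntidiagonal.mem_antidiagonal] at hij
  split_ifs with h
  · simp
  -- The term `r = 0` has been dropped and `r` shifted, so only `k` summands remain. They suffice
  -- since `ij.1 > 0` forces `ij.2 < k`.
  · rw [expCoeff_eq_sum (show ij.2 < k by omega)]

theorem expCoeff_zero : expCoeff a 0 = 1 := by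
  simp [expCoeff]

/-- The commutator with an operator. -/
def ad (X : Module.End ℂ SecFin) : Module.End ℂ SecFin →ₗ[ℂ] Module.End ℂ SecFin :=
  LinearMap.mulLeft ℂ X - LinearMap.mulRight ℂ X

@[simp] theorem ad_apply (X A : Module.End ℂ SecFin) : ad X A = X * A - A * X := rfl

theorem ad_expCoeff (X : Module.End ℂ SecFin)
    (hc : ∀ m n, 0 < m → 0 < n → Commute (X * a m - a m * X) (a n)) (k : ℕ) :
    X * expCoeff a k - expCoeff a k * X = ∑ ij ∈ Finset.HasAntidiagonal.antidiagonal k,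
      (if ij.1 = 0 then 0 else X * a ij.1 - a ij.1 * X) * expCoeff a ij.2 :=
  derivation_expCoeff (fun _ => ad X)
    (fun i j x y => by simp only [ad_apply]; noncomm_ring) hc k

/-- The derivation that adds a multiple of the degree to the commutator with an operator. -/
def adDeg (X : Module.End ℂ SecFin) (c : ℂ) (k : ℕ) :
    Module.End ℂ SecFin →ₗ[ℂ] Module.End ℂ SecFin :=
  ad X + (c * k) • LinearMap.id

theorem adDeg_apply (X : Module.End ℂ SecFin) (c : ℂ) (k : ℕ) (A : Module.End ℂ SecFin) :
    adDeg X c k A = X * A - A * X + (c * k) • A := rfl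

theorem adDeg_expCoeff (X : Module.End ℂ SecFin) (c : ℂ)
    (hc : ∀ m n, 0 < m → 0 < n → Commute (adDeg X c m (a m)) (a n)) (k : ℕ) :
    adDeg X c k (expCoeff a k) = ∑ ij ∈ Finset.HasAntidiagonal.antidiagonal k,
      (if ij.1 = 0 then 0 else adDeg X c ij.1 (a ij.1)) * expCoeff a ij.2 := by
  refine derivation_expCoeff (adDeg X c) (fun i j x y => ?_) hc k
  simp only [adDeg_apply, mul_add, add_mul, smul_mul_assoc, mul_smul_comm, mul_sub, sub_mul,
    mul_assoc]
  push_cast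
  module

theorem commute_expCoeff {X : Module.End ℂ SecFin} (h : ∀ n, 0 < n → Commute X (a n)) (k : ℕ) :
    Commute X (expCoeff a k) := by
  have h0 : ∀ n, 0 < n → X * a n - a n * X = 0 := fun n hn => sub_eq_zero.2 (h n hn)
  refine sub_eq_zero.1 ?_
  rw [ad_expCoeff X (fun m n hm _ => by rw [h0 m hm]; exact Commute.zero_left _)]
  refine Finset.sum_eq_zero fun ij _ => ?_
  split_ifs with h
  · simp
  · rw [h0 _ (by omega), zero_mul]

theorem isAdj_expCoeff {b : ℕ → Module.End ℂ SecFin} (h : ∀ n, IsAdj (a n) (b n)) (k : ℕ) :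
    IsAdj (expCoeff a k) (expCoeff b k) := by
  have hexp : ∀ k, IsAdj (PowerSeries.coeff k (expo a)) (PowerSeries.coeff k (expo b)) := by
    intro k
    simp only [expo, PowerSeries.coeff_mk]
    split_ifs
    exacts [IsAdj.zero, h k]
  have hpow : ∀ r k, IsAdj (PowerSeries.coeff k (expo a ^ r)) (PowerSeries.coeff k (expo b ^ r)) := by
    intro r
    induction r with
    | zero =>
      intro k
      simp only [pow_zero, PowerSeries.coeff_one]
      split_ifs
      exacts [IsAdj.one, IsAdj.zero]
    | succ r ih =>
      intro k
      -- Adjoints reverse products, so the new factor is split off on opposite sides.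
      rw [pow_succ (expo a), pow_succ' (expo b), PowerSeries.coeff_mul, PowerSeries.coeff_mul,
        ← Finset.Nat.sum_antidiagonal_swap (f := fun ij => PowerSeries.coeff ij.1 (expo b) * _)]
      exact IsAdj.sum _ fun ij _ => (ih ij.1).mul (hexp ij.2)
  rw [expCoeff_eq_sum k.lt_succ_self, expCoeff_eq_sum k.lt_succ_self]
  exact IsAdj.sum _ fun r _ => (hpow r k).smul_of_conj_eq (by simp)

end expCoeff

/-! ## The operators `E⁺` and `E⁻` -/

/-- The coefficients of `E⁻(α, z)`, indexed by the integers. -/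
def Em (α : ℝ) (p : ℤ) : Module.End ℂ SecFin := if 0 ≤ p then Eminus α p.toNat else 0

/-- The coefficients of `E⁺(α, z)`, indexed by the integers. -/
def Ep (α : ℝ) (p : ℤ) : Module.End ℂ SecFin := if 0 ≤ p then Eplus α p.toNat else 0

theorem Em_natCast (α : ℝ) (p : ℕ) : Em α (p : ℤ) = Eminus α p := by simp [Em]

theorem Ep_natCast (α : ℝ) (p : ℕ) : Ep α (p : ℤ) = Eplus α p := by simp [Ep]

theorem Em_of_neg (α : ℝ) {p : ℤ} (hp : p < 0) : Em α p = 0 := if_neg (by omega)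

theorem Ep_of_neg (α : ℝ) {p : ℤ} (hp : p < 0) : Ep α p = 0 := if_neg (by omega)

theorem Ep_zero (α : ℝ) : Ep α 0 = 1 := expCoeff_zero

theorem commute_J_of_neg (β : ℝ) {m n : ℤ} (hm : m < 0) (hn : n < 0) : Commute (J β m) (J β n) := by
  have := J_mul_J β m n
  rwa [if_neg (by omega), add_zero] at this

theorem commute_J_of_pos (β : ℝ) {m n : ℤ} (hm : 0 < m) (hn : 0 < n) : Commute (J β m) (J β n) := by
  have := J_mul_J β m n
  rwa [if_neg (by omega), add_zero] at this

theorem isAdj_Ep (α : ℝ) (p : ℤ) : IsAdj (Ep α p) (Em (-α) p) := by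
  unfold Ep Em
  split_ifs
  · refine isAdj_expCoeff (fun n => ?_) _
    have := (isAdj_J 0 n).smul (-((α : ℂ) / (n : ℂ)))
    convert this using 2
    simp [neg_div]
  · exact IsAdj.zero

theorem isAdj_Em (α : ℝ) (p : ℤ) : IsAdj (Em α p) (Ep (-α) p) := by
  have := (isAdj_Ep (-α) p).symm
  rwa [neg_neg] at this

theorem commute_Ep (α α' : ℝ) (p q : ℤ) : Commute (Ep α p) (Ep α' q) := by
  unfold Ep
  split_ifs
  · refine commute_expCoeff (fun n hn => (commute_expCoeff (fun m hm => ?_) _).symm) _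
    refine ((commute_J_of_pos 0 ?_ ?_).smul_left _).smul_right _ <;> omega
  · exact Commute.zero_right _
  · exact Commute.zero_left _
  · exact Commute.zero_left _

/-- The commutator of `J_m`, `m > 0`, with `E⁻`. -/
theorem J_mul_Em (α : ℝ) {m : ℕ} (hm : 0 < m) (p : ℤ) :
    J 0 m * Em α p = Em α p * J 0 m + (α : ℂ) • Em α (p - m) := by
  rcases lt_or_ge p 0 with hp | hp
  · rw [Em_of_neg α hp, Em_of_neg α (by omega)]; simp
  lift p to ℕ using hp
  -- The commutator with the exponent is the scalar α t^m, so the chain rule multiplies E⁻ by it.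
  have hcm : ∀ n : ℕ, J 0 m * ((α : ℂ) / (n : ℂ)) • J 0 (-(n : ℤ)) -
      ((α : ℂ) / (n : ℂ)) • J 0 (-(n : ℤ)) * J 0 m = if m = n then (α : ℂ) • 1 else 0 := by
    intro n
    rw [mul_smul_comm, smul_mul_assoc, J_mul_J 0 m (-n), smul_add, add_sub_cancel_left, neg_neg]
    by_cases h : m = n
    · subst h
      rw [if_pos rfl, if_pos rfl, smul_smul]
      push_cast
      rw [div_mul_cancel₀ _ (by exact_mod_cast hm.ne')]
    · rw [if_neg (by omega), if_neg h, smul_zero]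
  have h := ad_expCoeff (a := fun n : ℕ => ((α : ℂ) / (n : ℂ)) • J 0 (-(n : ℤ))) (J 0 m)
    (fun i j _ _ => by
      rw [hcm]
      split_ifs
      · exact (Commute.one_left _).smul_left _
      · exact Commute.zero_left _) p
  rw [Em_natCast, ← sub_eq_iff_eq_add', Eminus, h]
  rcases lt_or_ge p m with hp | hp
  · rw [Em_of_neg α (by omega), smul_zero]
    refine Finset.sum_eq_zero fun ij hij => ?_
    rw [Finset.HasAntidiagonal.mem_antidiagonal] at hij
    rw [hcm, if_neg (show ¬m = ij.1 by omega), ite_self, zero_mul]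
  · rw [Finset.sum_eq_single (m, p - m)]
    · rw [hcm, if_pos rfl, if_neg hm.ne', smul_mul_assoc, one_mul, ← Nat.cast_sub hp, Em_natCast,
        Eminus]
    · intro ij hij hne
      rw [Finset.HasAntidiagonal.mem_antidiagonal] at hij
      have hne' : ¬m = ij.1 := by
        rintro rfl
        exact hne (Prod.ext rfl (by simp; omega))
      rw [hcm, if_neg hne', ite_self, zero_mul]
    · intro hn
      exact absurd (Finset.HasAntidiagonal.mem_antidiagonal.2 (by simp; omega)) hn

/-- The commutator of `J_{-1}` with `E⁺`. -/
theorem J_neg_one_mul_Ep (α : ℝ) (q : ℤ) :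
    J 0 (-1) * Ep α q = Ep α q * J 0 (-1) + (α : ℂ) • Ep α (q - 1) := by
  have h := ((J_mul_Em (-α) one_pos q))
  have h1 := ((isAdj_J 0 (1 : ℕ)).mul (isAdj_Em (-α) q))
  rw [h] at h1
  -- The relation of `J_mul_Em` for `-α` and `m = 1` is passed to adjoints.
  have h2 := h1.unique (((isAdj_Em (-α) q).mul (isAdj_J 0 (1 : ℕ))).add
    ((isAdj_Em (-α) (q - (1 : ℕ))).smul _))
  simp only [neg_neg, Nat.cast_one] at h2
  rw [h2]
  simp

theorem J_neg_one_mul_Em (α : ℝ) (p : ℤ) : Commute (J 0 (-1)) (Em α p) := by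
  unfold Em
  split_ifs
  · exact commute_expCoeff (fun n hn =>
      (commute_J_of_neg 0 (by decide) (by omega)).smul_right _) _
  · exact Commute.zero_right _

/-- The coefficients of t (exp A)' = (t A') exp A: the derivation `adDeg` with zero operator is t
d/dt. -/
theorem smul_Eplus (α : ℝ) (q : ℕ) : (q : ℂ) • Eplus α q = ∑ ij ∈ Finset.HasAntidiagonal.antidiagonal q,
    (if ij.1 = 0 then 0 else (-(α : ℂ)) • J 0 ij.1) * Eplus α ij.2 := by
  have hcm : ∀ n : ℕ, 0 < n → adDeg 0 1 n ((-((α : ℂ) / (n : ℂ))) • J 0 (n : ℤ)) =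
      (-(α : ℂ)) • J 0 (n : ℤ) := by
    intro n hn
    rw [adDeg_apply, zero_mul, mul_zero, sub_zero, zero_add, one_mul, smul_smul, mul_neg, mul_div_cancel₀]
    exact_mod_cast hn.ne'
  have h := adDeg_expCoeff (a := fun n : ℕ => (-((α : ℂ) / (n : ℂ))) • J 0 (n : ℤ)) 0 1
    (fun i j hi hj => by
      rw [hcm i hi]
      exact ((commute_J_of_pos 0 (by omega) (by omega)).smul_left _).smul_right _) q
  rw [adDeg_apply, zero_mul, mul_zero, sub_zero, zero_add, one_mul] at h
  rw [Eplus, h]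
  refine Finset.sum_congr rfl fun ij _ => ?_
  split_ifs with h0
  · simp
  · rw [hcm _ (by omega), Eplus]

theorem smul_Eminus (α : ℝ) (q : ℕ) : (q : ℂ) • Eminus α q = ∑ ij ∈ Finset.HasAntidiagonal.antidiagonal q,
    (if ij.1 = 0 then 0 else (α : ℂ) • J 0 (-(ij.1 : ℤ))) * Eminus α ij.2 := by
  have hcm : ∀ n : ℕ, 0 < n → adDeg 0 1 n (((α : ℂ) / (n : ℂ)) • J 0 (-(n : ℤ))) =
      (α : ℂ) • J 0 (-(n : ℤ)) := by
    intro n hn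
    rw [adDeg_apply, zero_mul, mul_zero, sub_zero, zero_add, one_mul, smul_smul, mul_div_cancel₀]
    exact_mod_cast hn.ne'
  have h := adDeg_expCoeff (a := fun n : ℕ => ((α : ℂ) / (n : ℂ)) • J 0 (-(n : ℤ))) 0 1
    (fun i j hi hj => by
      rw [hcm i hi]
      exact ((commute_J_of_neg 0 (by omega) (by omega)).smul_left _).smul_right _) q
  rw [adDeg_apply, zero_mul, mul_zero, sub_zero, zero_add, one_mul] at h
  rw [Eminus, h]
  refine Finset.sum_congr rfl fun ij _ => ?_
  split_ifs with h0
  · simp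
  · rw [hcm _ (by omega), Eminus]

/-- The recursion of `smul_Eplus` with a range independent of `q`: the additional terms contain
negative coefficients of E⁺ and vanish. -/
theorem smul_Ep (α : ℝ) {q : ℤ} {M : ℕ} (hM : q ≤ M) : (q : ℂ) • Ep α q =
    (-(α : ℂ)) • ∑ m ∈ Finset.range M, J 0 ((m + 1 : ℕ) : ℤ) * Ep α (q - (m + 1 : ℕ)) := by
  rcases lt_or_ge q 0 with hq | hq
  · rw [Ep_of_neg α hq, smul_zero, Finset.sum_eq_zero, smul_zero]
    intro m _
    rw [Ep_of_neg α (by omega), mul_zero]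
  lift q to ℕ using hq
  have hM' : q ≤ M := by exact_mod_cast hM
  rw [Ep_natCast, Int.cast_natCast, smul_Eplus, Finset.smul_sum]
  cases q with
  | zero =>
    rw [Finset.sum_eq_zero (s := Finset.range M)]
    · simp
    · intro m _
      rw [Ep_of_neg α (by omega), mul_zero, smul_zero]
  | succ q =>
    rw [Finset.Nat.sum_antidiagonal_succ, if_pos rfl, zero_mul, zero_add,
      Finset.Nat.sum_antidiagonal_eq_sum_range_succ_mk]
    refine Eq.trans (Finset.sum_congr rfl fun m hm => ?_)
      (Finset.sum_subset (Finset.range_subset_range.2 hM') fun m _ hm => ?_)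
    · rw [Finset.mem_range] at hm
      rw [if_neg (Nat.succ_ne_zero m), smul_mul_assoc,
        show (((q + 1 : ℕ) : ℤ) - (m + 1 : ℕ)) = ((q - m : ℕ) : ℤ) by omega, Ep_natCast]
    · rw [Finset.mem_range, not_lt] at hm
      rw [Ep_of_neg α (by omega), mul_zero, smul_zero]

/-! ## Normal ordering -/

/-- The coefficients of `(1 - x) ^ γ`. -/
def binom (γ : ℝ) : ℕ → ℝ
  | 0 => 1
  | n + 1 => binom γ n * ((n - γ) / (n + 1))

theorem binom_succ (γ : ℝ) (n : ℕ) : binom γ (n + 1) = binom γ n * ((n - γ) / (n + 1)) := rfl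

/-- The coefficients of x f' = -γ x (1 - x)⁻¹ f for f = (1 - x)^γ. It is the recursion that normal
ordering produces. -/
theorem mul_binom (γ : ℝ) (n : ℕ) :
    (n : ℝ) * binom γ n = -γ * ∑ i ∈ Finset.range n, binom γ i := by
  induction n with
  | zero => simp
  | succ n ih =>
    rw [Finset.sum_range_succ, mul_add, ← ih, binom_succ]
    have : (n : ℝ) + 1 ≠ 0 := by positivity
    push_cast
    field_simp
    ring

/-- The identity E⁺(α,z)E⁻(α',w) = (1 - w/z)^{αα'} E⁻(α',w)E⁺(α,z) in coefficients. By induction on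
`P`: P E⁺_P is expanded by `smul_Ep`, each current is moved past E⁻ by `J_mul_Em`, and the outcome
is compared with `mul_binom`. -/
theorem Ep_mul_Em (α α' : ℝ) (P Q : ℤ) {M : ℕ} (hM : P < M) :
    Ep α P * Em α' Q =
      ∑ i ∈ Finset.range M, (binom (α * α') i : ℂ) • (Em α' (Q - i) * Ep α (P - i)) := by
  -- The recursion refers to all smaller `P`, so the induction runs over an upper bound `n`, with
  -- the range `M` kept fixed.
  have key : ∀ (n : ℕ) (P : ℤ), P < n → P < M → Ep α P * Em α' Q =
      ∑ i ∈ Finset.range M, (binom (α * α') i : ℂ) • (Em α' (Q - i) * Ep α (P - i)) := by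
    intro n
    induction n with
    | zero =>
      intro P hP _
      rw [Ep_of_neg α (by omega), zero_mul, Finset.sum_eq_zero]
      intro i _
      rw [Ep_of_neg α (by omega), mul_zero, smul_zero]
    | succ n ih =>
      intro P hP hPM
      rcases lt_trichotomy P 0 with h0 | rfl | h0
      · exact ih P (by omega) hPM
      · rw [Finset.sum_eq_single_of_mem 0 (by simp; omega)]
        · simp [Ep_zero, binom]
        · intro i _ hi
          rw [Ep_of_neg α (by omega), mul_zero, smul_zero]
      have hP0 : (P : ℂ) ≠ 0 := by exact_mod_cast h0.ne'
      refine smul_right_injective _ hP0 ?_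
      dsimp only
      set T : ℕ → Module.End ℂ SecFin := fun n => Em α' (Q - n) * Ep α (P - n) with hT
      set b : ℕ → ℂ := fun i => (binom (α * α') i : ℂ) with hb
      have hTM : ∀ n, M ≤ n → T n = 0 := fun n hn => by
        simp only [hT]; rw [Ep_of_neg α (by omega), mul_zero]
      have e1 : ∀ m ∈ Finset.range M, J 0 ((m + 1 : ℕ) : ℤ) * Ep α (P - (m + 1 : ℕ)) * Em α' Q =
          ∑ i ∈ Finset.range M, (b i • (Em α' (Q - i) * (J 0 ((m + 1 : ℕ) : ℤ) *
            Ep α (P - i - (m + 1 : ℕ)))) + (b i * α') • T (m + (i + 1))) := by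
        intro m _
        rw [mul_assoc, ih _ (by omega) (by omega), Finset.mul_sum]
        refine Finset.sum_congr rfl fun i _ => ?_
        rw [mul_smul_comm, ← mul_assoc, J_mul_Em α' (Nat.succ_pos m), add_mul, smul_add,
          smul_mul_assoc, smul_smul, mul_assoc,
          show P - (m + 1 : ℕ) - i = P - i - (m + 1 : ℕ) by ring,
          show Q - i - (m.succ : ℕ) = Q - (m + (i + 1) : ℕ) by push_cast; ring,
          show P - i - (m + 1 : ℕ) = P - (m + (i + 1) : ℕ) by push_cast; ring]
      have e2 : ∀ i ∈ Finset.range M, ∑ m ∈ Finset.range M, T (m + (i + 1)) =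
          ∑ n ∈ Finset.Ico (i + 1) M, T n := by
        intro i hi
        rw [Finset.mem_range] at hi
        rw [Finset.range_eq_Ico, Finset.sum_Ico_add', zero_add]
        refine (Finset.sum_subset (Finset.Ico_subset_Ico_right (by omega)) fun n h1 h2 => ?_).symm
        rw [Finset.mem_Ico] at h1 h2
        exact hTM n (by omega)
      have e3 : ∑ i ∈ Finset.range M, ∑ n ∈ Finset.Ico (i + 1) M, b i • T n =
          ∑ n ∈ Finset.range M, (∑ i ∈ Finset.range n, b i) • T n := by
        simp only [Finset.sum_smul]
        refine Finset.sum_comm' fun i n => ?_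
        simp only [Finset.mem_range, Finset.mem_Ico]
        omega
      have e4 : ∀ i : ℕ, (-(α : ℂ)) • ∑ m ∈ Finset.range M, (J 0 ((m + 1 : ℕ) : ℤ) *
            Ep α (P - i - (m + 1 : ℕ))) = ((P : ℂ) - i) • Ep α (P - i) := by
        intro i
        rw [← smul_Ep α (show P - i ≤ M by omega)]
        push_cast; rfl
      have s1 : ∑ m ∈ Finset.range M, ∑ i ∈ Finset.range M, b i • (Em α' (Q - i) *
          (J 0 ((m + 1 : ℕ) : ℤ) * Ep α (P - i - (m + 1 : ℕ)))) =
          ∑ i ∈ Finset.range M, b i • (Em α' (Q - i) * ∑ m ∈ Finset.range M,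
            (J 0 ((m + 1 : ℕ) : ℤ) * Ep α (P - i - (m + 1 : ℕ)))) := by
        rw [Finset.sum_comm]
        simp only [Finset.mul_sum, Finset.smul_sum]
      have s2 : ∑ m ∈ Finset.range M, ∑ i ∈ Finset.range M, (b i * α') • T (m + (i + 1)) =
          (α' : ℂ) • ∑ n ∈ Finset.range M, (∑ i ∈ Finset.range n, b i) • T n := by
        rw [Finset.sum_comm, ← e3, Finset.smul_sum]
        refine Finset.sum_congr rfl fun i hi => ?_
        rw [← Finset.smul_sum, e2 i hi, ← Finset.smul_sum, mul_comm, mul_smul]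
      rw [← smul_mul_assoc, smul_Ep α hPM.le, smul_mul_assoc, Finset.sum_mul,
        Finset.sum_congr rfl e1]
      simp only [Finset.sum_add_distrib]
      rw [s1, s2, smul_add, smul_smul, Finset.smul_sum, Finset.smul_sum, Finset.smul_sum,
        ← Finset.sum_add_distrib]
      refine Finset.sum_congr rfl fun i _ => ?_
      -- Moving the currents leaves the weight (P - i) b_i together with -αα' ∑_{k<i} b_k. The
      -- latter equals i b_i, so the total is P b_i.
      have hrec : (i : ℂ) * b i = -(α * α') * ∑ k ∈ Finset.range i, b k := by
        simp only [hb]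
        exact_mod_cast congrArg (fun x : ℝ => (x : ℂ)) (mul_binom (α * α') i)
      rw [smul_comm, ← mul_smul_comm, e4, mul_smul_comm, smul_smul, smul_smul, smul_smul,
        ← add_smul]
      congr 1
      linear_combination -hrec
  exact key (P.toNat + 1) P (by omega) hM

/-! ## Energy -/

/-- The sum of the commutator with L₀ and the degree is a derivation that kills every term of the
exponent, hence also the exponential. -/
theorem L_zero_mul_Ep (α : ℝ) (q : ℤ) :
    L 0 0 * Ep α q = Ep α q * L 0 0 - (q : ℂ) • Ep α q := by
  rcases lt_or_ge q 0 with hq | hq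
  · rw [Ep_of_neg α hq]; simp
  lift q to ℕ using hq
  have hcm : ∀ n : ℕ, adDeg (L 0 0) 1 n ((-((α : ℂ) / (n : ℂ))) • J 0 (n : ℤ)) = 0 := by
    intro n
    rw [adDeg_apply, mul_smul_comm, L_mul_J, smul_mul_assoc, add_zero]
    push_cast
    module
  have h := adDeg_expCoeff (a := fun n : ℕ => (-((α : ℂ) / (n : ℂ))) • J 0 (n : ℤ)) (L 0 0) 1
    (fun i j _ _ => by rw [hcm]; exact Commute.zero_left _) q
  rw [Finset.sum_eq_zero (fun ij _ => by rw [hcm, ite_self, zero_mul]), adDeg_apply] at h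
  rw [Ep_natCast, Eplus, ← sub_eq_zero, ← h]
  push_cast
  module

theorem L_zero_mul_Em (α : ℝ) (p : ℤ) :
    L 0 0 * Em α p = Em α p * L 0 0 + (p : ℂ) • Em α p := by
  have hL : IsAdj (L 0 0) (L 0 0) := isAdj_L 0 0
  have h1 := (isAdj_Ep (-α) p).mul hL |>.sub ((isAdj_Ep (-α) p).smul (p : ℂ))
  rw [← L_zero_mul_Ep, neg_neg] at h1
  have h2 := (hL.mul (isAdj_Ep (-α) p)).unique h1
  rw [neg_neg] at h2
  rw [h2]; simp

/-- `x` is an eigenvector of the conformal Hamiltonian of charge zero with eigenvalue `n`. -/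
def HasEnergy (n : ℤ) (x : SecFin) : Prop := L 0 0 x = (n : ℂ) • x

theorem hasEnergy_ket (ν : Occ) : HasEnergy (energy ν) (ket ν) := by
  simp [HasEnergy, L_zero_ket]

theorem HasEnergy.inner_eq_zero {m n : ℤ} {x y : SecFin} (hx : HasEnergy m x) (hy : HasEnergy n y)
    (h : m ≠ n) : inner ℂ (embed0 x) (embed0 y) = 0 := by
  have hL : IsAdj (L 0 0) (L 0 0) := isAdj_L 0 0
  have h1 := hL x y
  rw [hx, hy, map_smul, map_smul, inner_smul_left, inner_smul_right, map_intCast,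
    ← sub_eq_zero, ← sub_mul] at h1
  refine (mul_eq_zero.1 h1).resolve_left ?_
  exact sub_ne_zero.2 (by exact_mod_cast h)

theorem eq_zero_of_inner_ket {x : SecFin}
    (h : ∀ ν, inner ℂ (embed0 x) (embed0 (ket ν)) = 0) : x = 0 := by
  apply embed0_injective
  rw [map_zero, ← inner_self_eq_zero (𝕜 := ℂ)]
  have : ∀ y, inner ℂ (embed0 x) (embed0 y) = 0 := fun y => by
    induction y using ket_induction with
    | zero => simp
    | add a b ha hb => rw [map_add, inner_add_right, ha, hb, add_zero]
    | smul c a ha => rw [map_smul, inner_smul_right, ha, mul_zero]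
    | ket ν => exact h ν
  exact this x

/-- The kets span and have nonnegative energy, so a vector of negative energy is orthogonal to
everything. This makes E⁺ locally finite. -/
theorem HasEnergy.eq_zero {n : ℤ} {x : SecFin} (hx : HasEnergy n x) (hn : n < 0) : x = 0 :=
  eq_zero_of_inner_ket fun ν => hx.inner_eq_zero (hasEnergy_ket ν) (by omega)

theorem HasEnergy.Ep {n : ℤ} {x : SecFin} (hx : HasEnergy n x) (α : ℝ) (q : ℤ) :
    HasEnergy (n - q) (Ep α q x) := by
  have := congrArg (fun A => A x) (L_zero_mul_Ep α q)
  simp only [Module.End.mul_apply, LinearMap.sub_apply, LinearMap.smul_apply] at this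
  rw [HasEnergy, this, hx, map_smul]
  push_cast
  module

theorem Ep_ket_eq_zero (α : ℝ) {ν : Occ} {q : ℤ} (hq : energy ν < q) : Ep α q (ket ν) = 0 :=
  ((hasEnergy_ket ν).Ep α q).eq_zero (by omega)

theorem Ep_Ep_ket_eq_zero (α α' : ℝ) {ν : Occ} {p q : ℤ} (hp : 0 ≤ p) (hq : energy ν < q) :
    Ep α q (Ep α' p (ket ν)) = 0 :=
  (((hasEnergy_ket ν).Ep α' p).Ep α q).eq_zero (by omega)

/-! ## Commutators with `L_{-1}` -/

/-- On the exponent of E⁻ the commutator with L₋₁ is d/dz without the lowest term α J₋₁. The term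
added on the left restores it, giving the derivative of E⁻. -/
theorem L_neg_one_mul_Em (α : ℝ) (p : ℤ) :
    L 0 (-1) * Em α p + (α : ℂ) • (J 0 (-1) * Em α p) =
      Em α p * L 0 (-1) + ((p : ℂ) + 1) • Em α (p + 1) := by
  rcases lt_or_ge p 0 with hp | hp
  · rw [Em_of_neg α hp]
    rcases eq_or_ne p (-1) with rfl | h1
    · simp
    · rw [Em_of_neg α (by omega)]; simp
  lift p to ℕ using hp
  have hcm : ∀ n : ℕ, 0 < n → L 0 (-1) * ((α : ℂ) / (n : ℂ)) • J 0 (-(n : ℤ)) -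
      ((α : ℂ) / (n : ℂ)) • J 0 (-(n : ℤ)) * L 0 (-1) = (α : ℂ) • J 0 (-((n + 1 : ℕ) : ℤ)) := by
    intro n hn
    have hn' : (n : ℂ) ≠ 0 := by exact_mod_cast hn.ne'
    rw [mul_smul_comm, smul_mul_assoc, L_mul_J 0 (-1) (-n), smul_sub, sub_sub_cancel_left, smul_smul,
      show -((n + 1 : ℕ) : ℤ) = -(n : ℤ) + -1 by push_cast; ring, ← neg_smul]
    congr 1
    push_cast
    field_simp
  have h := ad_expCoeff (a := fun n : ℕ => ((α : ℂ) / (n : ℂ)) • J 0 (-(n : ℤ))) (L 0 (-1))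
    (fun i j hi hj => by
      rw [hcm i hi]
      exact ((commute_J_of_neg 0 (by omega) (by omega)).smul_left _).smul_right _) p
  have h' := smul_Eminus α (p + 1)
  rw [Finset.Nat.sum_antidiagonal_succ, if_pos rfl, zero_mul, zero_add] at h'
  rw [← sub_eq_iff_eq_add', show (p : ℤ) + 1 = ((p + 1 : ℕ) : ℤ) by push_cast; rfl, Em_natCast,
    Em_natCast, Int.cast_natCast, show (p : ℂ) + 1 = ((p + 1 : ℕ) : ℂ) by push_cast; rfl, h',
    add_sub_right_comm]
  change L 0 (-1) * expCoeff _ p - expCoeff _ p * L 0 (-1) + _ = _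
  rw [h]
  have h0 : (α : ℂ) • (J 0 (-1) * Eminus α p) = ∑ ij ∈ Finset.HasAntidiagonal.antidiagonal p,
      if ij = (0, p) then (α : ℂ) • (J 0 (-1) * Eminus α p) else 0 := by
    rw [Finset.sum_ite_eq', if_pos (by simp)]
  rw [h0, ← Finset.sum_add_distrib]
  refine Finset.sum_congr rfl fun ij hij => ?_
  rw [Finset.HasAntidiagonal.mem_antidiagonal] at hij
  rw [if_neg (Nat.succ_ne_zero _)]
  by_cases hi : ij.1 = 0
  · have hj : ij = (0, p) := Prod.ext hi (by simp; omega)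
    subst hj
    simp
  · rw [if_neg hi, if_neg (fun h => hi (by rw [h])), add_zero, hcm _ (by omega)]
    rfl

/-- Here the commutator with L₋₁ is d/dz exactly: the surplus term α J₀ z⁻¹ vanishes at charge zero.
-/
theorem L_neg_one_mul_Ep (α : ℝ) (q : ℤ) :
    L 0 (-1) * Ep α q = Ep α q * L 0 (-1) - ((q : ℂ) - 1) • Ep α (q - 1) := by
  rcases le_or_gt q 0 with hq | hq
  · rw [Ep_of_neg α (show q - 1 < 0 by omega)]
    rcases eq_or_ne q 0 with rfl | h1
    · simp [Ep_zero]
    · rw [Ep_of_neg α (by omega)]; simp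
  obtain ⟨q, rfl⟩ : ∃ n : ℕ, q = ((n + 1 : ℕ) : ℤ) := ⟨(q - 1).toNat, by omega⟩
  have hcm : ∀ n : ℕ, 0 < n → L 0 (-1) * (-((α : ℂ) / (n : ℂ))) • J 0 (n : ℤ) -
      (-((α : ℂ) / (n : ℂ))) • J 0 (n : ℤ) * L 0 (-1) = (α : ℂ) • J 0 ((n : ℤ) - 1) := by
    intro n hn
    have hn' : (n : ℂ) ≠ 0 := by exact_mod_cast hn.ne'
    rw [mul_smul_comm, smul_mul_assoc, L_mul_J 0 (-1) n, smul_sub, sub_sub_cancel_left, smul_smul,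
      ← neg_smul, sub_eq_add_neg (n : ℤ)]
    congr 1
    push_cast
    field_simp
  have h := ad_expCoeff (a := fun n : ℕ => (-((α : ℂ) / (n : ℂ))) • J 0 (n : ℤ)) (L 0 (-1))
    (fun i j hi hj => by
      rw [hcm i hi]
      rcases Nat.lt_or_ge 1 i with h1 | h1
      · exact ((commute_J_of_pos 0 (by omega) (by omega)).smul_left _).smul_right _
      · obtain rfl : i = 1 := by omega
        simp [J_zero]) (q + 1)
  rw [Finset.Nat.sum_antidiagonal_succ, if_pos rfl, zero_mul, zero_add] at h
  have h' := smul_Eplus α q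
  rw [sub_eq_add_neg (Ep α _ * _), ← sub_eq_iff_eq_add', ← smul_neg,
    show (((q + 1 : ℕ) : ℤ) - 1) = (q : ℤ) by push_cast; ring, Ep_natCast,
    Ep_natCast, Int.cast_natCast, show ((q + 1 : ℕ) : ℂ) - 1 = (q : ℂ) by push_cast; ring,
    smul_neg, h']
  change L 0 (-1) * expCoeff _ (q + 1) - expCoeff _ (q + 1) * L 0 (-1) = _
  rw [h, ← Finset.sum_neg_distrib]
  refine Finset.sum_congr rfl fun ij _ => ?_
  rw [if_neg (Nat.succ_ne_zero _), hcm _ (Nat.succ_pos _),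
    show (((ij.1 + 1 : ℕ) : ℤ) - 1) = (ij.1 : ℤ) by push_cast; ring, Eplus]
  split_ifs with h0
  · simp [h0, J_zero]
  · simp

/-! ## The modes of the charged field -/

/-- The coefficient of `z ^ N` in `E⁻(α, z) E⁺(α, z)`. -/
def V (α : ℝ) (N : ℤ) : Module.End ℂ SecFin := opSum fun q : ℤ => Em α (N + q) * Ep α q

theorem locFin_Ep (α : ℝ) : LocFin fun q : ℤ => Ep α q := by
  refine locFin_of_ket fun ν => (Set.finite_Icc 0 (energy ν : ℤ)).subset fun q hq => ?_
  by_contra h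
  rw [Set.mem_Icc, not_and_or, not_le, not_le] at h
  rcases h with h | h
  · exact hq (by dsimp only; rw [Ep_of_neg α h, LinearMap.zero_apply])
  · exact hq (Ep_ket_eq_zero α h)

theorem locFin_V (α : ℝ) (N : ℤ) : LocFin fun q : ℤ => Em α (N + q) * Ep α q :=
  (locFin_Ep α).mul_left _

theorem V_ket (α : ℝ) (N : ℤ) {ν : Occ} {R : ℕ} (hR : energy ν < R) :
    V α N (ket ν) = ∑ q ∈ Finset.range R, Em α (N + q) (Ep α q (ket ν)) := by
  rw [V, opSum_apply_eq_sum (locFin_V α N) _ ((Finset.range R).map Nat.castEmbedding),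
    Finset.sum_map]
  · rfl
  · intro q hq
    rw [Module.End.mul_apply]
    rcases lt_or_ge q 0 with h | h
    · rw [Ep_of_neg α h, LinearMap.zero_apply, map_zero]
    · lift q to ℕ using h
      have : R ≤ q := by simpa using hq
      rw [Ep_ket_eq_zero α (by omega), map_zero]

/-- Termwise, E⁻_{N+q}E⁺_q has the adjoint E⁻_q E⁺_{N+q} of opposite charge; a shift of `q` by `N`
brings the sum to the form of `V`. -/
theorem isAdj_V (α : ℝ) (N : ℤ) : IsAdj (V α N) (V (-α) (-N)) := by
  have h := opSum_equiv (locFin_V (-α) (-N)) (Equiv.addRight N)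
  rw [V, V, ← h]
  refine (locFin_V α N).isAdj ((locFin_V (-α) (-N)).comp (Equiv.addRight N).injective) fun q => ?_
  have := (isAdj_Em α (N + q)).mul (isAdj_Ep α q)
  simp only [Equiv.coe_addRight]
  rwa [show -N + (q + N) = q by ring, add_comm q N]

theorem L_zero_mul_V (α : ℝ) (N : ℤ) : L 0 0 * V α N = V α N * L 0 0 + (N : ℂ) • V α N := by
  have hl := locFin_V α N
  rw [V, mul_opSum hl, opSum_mul hl, ← opSum_smul hl, ← opSum_add (hl.mul_right _) (hl.smul _)]
  congr 1
  funext q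
  rw [← mul_assoc, L_zero_mul_Em, add_mul, mul_assoc, L_zero_mul_Ep, mul_sub, mul_assoc,
    smul_mul_assoc, mul_smul_comm]
  push_cast
  module

theorem HasEnergy.V {n : ℤ} {x : SecFin} (hx : HasEnergy n x) (α : ℝ) (N : ℤ) :
    HasEnergy (n + N) (V α N x) := by
  have := congrArg (fun A => A x) (L_zero_mul_V α N)
  simp only [Module.End.mul_apply, LinearMap.add_apply, LinearMap.smul_apply] at this
  rw [HasEnergy, this, hx, map_smul]
  push_cast
  module

/-! ### The charged field as a primary field -/

theorem locFin_V_shift (α : ℝ) (N : ℤ) : LocFin fun q : ℤ => Em α (N + q) * Ep α (q - 1) :=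
  ((locFin_Ep α).comp (sub_left_injective (b := (1 : ℤ)))).mul_left _

theorem opSum_shift (α : ℝ) (N : ℤ) (c : ℤ → ℂ) :
    opSum (fun q : ℤ => c q • (Em α (N + q) * Ep α (q - 1))) =
      opSum fun q : ℤ => c (q + 1) • (Em α (N + 1 + q) * Ep α q) := by
  rw [← opSum_equiv ((locFin_V_shift α N).smul c) (Equiv.addRight (1 : ℤ))]
  congr 1
  funext q
  rw [Equiv.coe_addRight, add_sub_cancel_right, ← add_assoc, add_right_comm]

theorem J_neg_one_mul_V (α : ℝ) (N : ℤ) :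
    J 0 (-1) * V α N = V α N * J 0 (-1) + (α : ℂ) • V α (N + 1) := by
  have hl := locFin_V α N
  have hs := opSum_shift α N fun _ => (α : ℂ)
  rw [opSum_smul (locFin_V α (N + 1))] at hs
  rw [V, mul_opSum hl, opSum_mul hl, V, ← hs,
    ← opSum_add (hl.mul_right _) ((locFin_V_shift α N).smul _)]
  congr 1
  funext q
  rw [← mul_assoc, (J_neg_one_mul_Em α _).eq, mul_assoc, J_neg_one_mul_Ep, mul_add, mul_assoc,
    mul_smul_comm]

theorem L_neg_one_mul_V_of_charge_zero (α : ℝ) (N : ℤ) :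
    L 0 (-1) * V α N + (α : ℂ) • (J 0 (-1) * V α N) =
      V α N * L 0 (-1) + ((N : ℂ) + 1) • V α (N + 1) := by
  have hl := locFin_V α N
  have hl' := locFin_V α (N + 1)
  have hs := opSum_shift α N fun q => -((q : ℂ) - 1)
  -- The product rule for d/dz: N + 1 = (N + q + 1) - q, the first part from E⁻ and the second from
  -- E⁺.
  have e1 : ((N : ℂ) + 1) • V α (N + 1) =
      opSum (fun q : ℤ => ((N : ℂ) + q + 1) • (Em α (N + 1 + q) * Ep α q)) +
      opSum (fun q : ℤ => (-((q : ℂ) - 1)) • (Em α (N + q) * Ep α (q - 1))) := by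
    rw [hs, ← opSum_add (hl'.smul _) (hl'.smul _), V, ← opSum_smul hl']
    congr 1
    funext q
    push_cast
    module
  rw [e1, V, mul_opSum hl, mul_opSum hl, opSum_mul hl, ← opSum_smul (hl.mul_left _),
    ← opSum_add (hl.mul_left _) ((hl.mul_left _).smul _),
    ← opSum_add (hl'.smul _) ((locFin_V_shift α N).smul _),
    ← opSum_add (hl.mul_right _) ((hl'.smul _).add ((locFin_V_shift α N).smul _))]
  congr 1
  funext q
  rw [← mul_assoc, ← mul_assoc, ← smul_mul_assoc, ← add_mul, L_neg_one_mul_Em, add_mul, mul_assoc,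
    L_neg_one_mul_Ep, mul_sub, mul_assoc, smul_mul_assoc, mul_smul_comm, add_right_comm N 1 q]
  push_cast
  module

/-- The charged field is primary: the commutator with `L₀`. -/
theorem L_zero_mul_V_charge (α β : ℝ) (N : ℤ) : L (β + α) 0 * V α N =
    V α N * L β 0 + ((N : ℂ) + α * β + α ^ 2 / 2) • V α N := by
  rw [L_zero_eq (β + α), L_zero_eq β, add_mul, mul_add, L_zero_mul_V, smul_mul_assoc, mul_smul_comm, one_mul,
    mul_one]
  push_cast
  module

/-- The charged field is primary: the commutator with `L_{-1}`. -/
theorem L_neg_one_mul_V (α β : ℝ) (N : ℤ) : L (β + α) (-1) * V α N =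
    V α N * L β (-1) + ((N : ℂ) + 1 + α * β) • V α (N + 1) := by
  have h := L_neg_one_mul_V_of_charge_zero α N
  rw [L_neg_one_eq (β + α), L_neg_one_eq β, add_mul, mul_add, smul_mul_assoc, mul_smul_comm]
  have h' : L 0 (-1) * V α N + ((β + α : ℝ) : ℂ) • (J 0 (-1) * V α N) =
      (L 0 (-1) * V α N + (α : ℂ) • (J 0 (-1) * V α N)) + (β : ℂ) • (J 0 (-1) * V α N) := by
    push_cast
    module
  rw [h', h, J_neg_one_mul_V]
  module

/-- The charged field is primary: the commutator with `L_1`. -/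
theorem L_one_mul_V (α β : ℝ) (N : ℤ) : L (β + α) 1 * V α N =
    V α N * L β 1 + ((N : ℂ) - 1 + α ^ 2 + α * β) • V α (N - 1) := by
  -- The relation for L₁ is the adjoint of the one for L₋₁ with charge `-α` acting from `β + α` to
  -- `β`; the start at `β + α` is the source of α².
  have h := L_neg_one_mul_V (-α) (β + α) (-N)
  rw [add_neg_cancel_right] at h
  have hV := isAdj_V (-α) (-N)
  have hV' := isAdj_V (-α) (-N + 1)
  have hL := isAdj_L β (-1)
  have hL' := isAdj_L (β + α) (-1)
  rw [neg_neg] at hL hL'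
  rw [neg_neg, neg_neg] at hV
  rw [neg_neg, show -(-N + 1) = N - 1 by ring] at hV'
  have h1 := hL.mul hV
  rw [h] at h1
  have h2 := h1.unique ((hV.mul hL').add (hV'.smul _))
  rw [h2]
  have : conj (((-N : ℤ) : ℂ) + 1 + ((-α : ℝ) : ℂ) * ((β + α : ℝ) : ℂ)) =
      -((N : ℂ) - 1 + α ^ 2 + α * β) := by
    simp only [map_add, map_mul, Complex.conj_ofReal, map_one, map_intCast]
    push_cast
    ring
  rw [this]
  module

/-- The modes of the charged field in terms of the coefficients of `E⁻ E⁺`. -/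
theorem Y_eq_V (α β s : ℝ) (N : ℤ) (h : s = -(α ^ 2 / 2) - α * β - N) : Y α β s = V α N := by
  classical
  refine fockBasis.ext fun ν => ?_
  have hcond : ∀ p q : ℕ, (p : ℝ) - (q : ℝ) + α * β = -s - α ^ 2 / 2 ↔ (p : ℤ) = N + q := by
    intro p q
    have : (p : ℤ) = N + q ↔ (p : ℝ) = N + q := by exact_mod_cast Iff.rfl
    rw [this, h]
    constructor <;> intro h' <;> linarith
  rw [Y, opSum, Module.Basis.constr_basis, V_ket α N (Nat.lt_succ_self _),
    finsum_eq_sum_of_support_subset (s := (Finset.range (energy ν).succ).image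
      fun q : ℕ => ((N + q).toNat, q)), Finset.sum_image]
  · refine Finset.sum_congr rfl fun q _ => ?_
    simp only [hcond]
    -- For `N + q < 0` the value of `toNat` is a dummy: the condition fails on one side and `Em`
    -- vanishes on the other.
    rcases lt_or_ge (N + q) 0 with hN | hN
    · rw [if_neg (by omega), Em_of_neg α hN]
      rfl
    · rw [if_pos (by omega), Ep_natCast, Em, if_pos hN, Module.End.mul_apply]
  · intro a _ b _ hab
    exact (Prod.ext_iff.1 hab).2
  · intro pq hpq
    rw [Function.mem_support] at hpq
    simp only [hcond] at hpq
    split_ifs at hpq with hc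
    · simp only [Finset.coe_image, Set.mem_image, Finset.mem_coe, Finset.mem_range]
      refine ⟨pq.2, ?_, Prod.ext (by simp only; omega) rfl⟩
      by_contra hq
      apply hpq
      rw [Module.End.mul_apply, ← Ep_natCast, Ep_ket_eq_zero α (by omega), map_zero]
    · exact absurd rfl hpq

theorem Y_eq_zero (α β s : ℝ) (h : ∀ N : ℤ, s ≠ -(α ^ 2 / 2) - α * β - N) : Y α β s = 0 := by
  refine fockBasis.ext fun ν => ?_
  rw [Y, opSum, Module.Basis.constr_basis, LinearMap.zero_apply]
  refine finsum_eq_zero_of_forall_eq_zero fun pq => ?_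
  rw [if_neg, LinearMap.zero_apply]
  intro h'
  refine h ((pq.1 : ℤ) - pq.2) ?_
  push_cast
  linarith

/-! ## Square summability of the binomial coefficients -/

/-- A telescoping bound in the manner of Raabe: n b_n² - (n+1) b_{n+1}² equals (n(1+2γ) - γ²)/(n+1)
· b_n². For n ≥ n₀ this is at least (1+2γ)/2 · b_n², and n₀ is the solution of that inequality. -/
theorem summable_binom_sq {γ : ℝ} (hγ : -(1 / 2) < γ) : Summable fun n => binom γ n ^ 2 := by
  have hpos : 0 < 1 + 2 * γ := by linarith
  obtain ⟨n₀, hn₀⟩ := exists_nat_ge ((1 + 2 * γ + 2 * γ ^ 2) / (1 + 2 * γ))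
  rw [div_le_iff₀ hpos] at hn₀
  rw [← summable_nat_add_iff n₀]
  refine (summable_mul_left_iff (half_pos hpos).ne').1 ?_
  have hstep : ∀ n : ℕ, n₀ ≤ n → (1 + 2 * γ) / 2 * binom γ n ^ 2 ≤
      n * binom γ n ^ 2 - (n + 1 : ℕ) * binom γ (n + 1) ^ 2 := by
    intro n hn
    have hn1 : (0 : ℝ) < n + 1 := by positivity
    have hnn : (n₀ : ℝ) ≤ n := by exact_mod_cast hn
    have e : n * binom γ n ^ 2 - (n + 1 : ℕ) * binom γ (n + 1) ^ 2 =
        (n * (1 + 2 * γ) - γ ^ 2) / (n + 1) * binom γ n ^ 2 := by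
      rw [binom_succ]
      push_cast
      field_simp
      ring
    rw [e]
    refine mul_le_mul_of_nonneg_right ?_ (sq_nonneg _)
    rw [le_div_iff₀ hn1]
    nlinarith [mul_le_mul_of_nonneg_right hnn hpos.le]
  refine summable_of_sum_range_le (c := n₀ * binom γ n₀ ^ 2) (fun n => by positivity) fun K => ?_
  have hK : ∀ K : ℕ, ∑ i ∈ Finset.range K, (1 + 2 * γ) / 2 * binom γ (i + n₀) ^ 2 ≤
      n₀ * binom γ n₀ ^ 2 - (K + n₀ : ℕ) * binom γ (K + n₀) ^ 2 := by
    intro K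
    induction K with
    | zero => simp
    | succ K ih =>
      rw [Finset.sum_range_succ]
      have := hstep (K + n₀) (by omega)
      rw [add_right_comm K 1 n₀]
      linarith
  refine (hK K).trans ?_
  have : 0 ≤ ((K + n₀ : ℕ) : ℝ) * binom γ (K + n₀) ^ 2 := by positivity
  linarith

/-- The coefficients of `(1 - x) ^ γ`, indexed by the integers. -/
def binomZ (γ : ℝ) (k : ℤ) : ℂ := if 0 ≤ k then (binom γ k.toNat : ℂ) else 0

theorem summable_binomZ_sq {γ : ℝ} (hγ : -(1 / 2) < γ) : Summable fun k => ‖binomZ γ k‖ ^ 2 := by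
  rw [← Function.Injective.summable_iff (Nat.cast_injective (R := ℤ))]
  · refine (summable_binom_sq hγ).congr fun n => ?_
    simp [binomZ]
  · intro k hk
    have : ¬ 0 ≤ k := fun h => hk ⟨k.toNat, by omega⟩
    simp [binomZ, this]

theorem summable_binomZ_mul {γ : ℝ} (hγ : -(1 / 2) < γ) (r s : ℤ) :
    Summable fun k => binomZ γ (k + r) * binomZ γ (k + s) := by
  have h := summable_binomZ_sq hγ
  have hr : Summable fun k => ‖binomZ γ (k + r)‖ ^ 2 :=
    h.comp_injective (add_left_injective r)
  have hs : Summable fun k => ‖binomZ γ (k + s)‖ ^ 2 :=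
    h.comp_injective (add_left_injective s)
  refine Summable.of_norm_bounded (hr.add hs) fun k => ?_
  rw [norm_mul]
  generalize ‖binomZ γ (k + r)‖ = a
  generalize ‖binomZ γ (k + s)‖ = b
  nlinarith [sq_nonneg (a - b), sq_nonneg a, sq_nonneg b]

/-- The autocorrelation of the coefficients of `(1 - x) ^ γ`, which is the Fourier transform of
`|1 - x| ^ (2 γ)` on the unit circle. -/
def corr (γ : ℝ) (r : ℤ) : ℂ := ∑' k, binomZ γ k * binomZ γ (k + r)

theorem tsum_binomZ_mul (γ : ℝ) (r s : ℤ) :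
    ∑' k, binomZ γ (k + r) * binomZ γ (k + s) = corr γ (s - r) := by
  rw [corr, ← (Equiv.addRight r).tsum_eq fun k => binomZ γ k * binomZ γ (k + (s - r))]
  refine tsum_congr fun k => ?_
  simp only [Equiv.coe_addRight]
  rw [show k + r + (s - r) = k + s by ring]

/-- A shift of the summation index exchanges the two factors. Locality rests on this symmetry. -/
theorem corr_neg (γ : ℝ) (r : ℤ) : corr γ (-r) = corr γ r := by
  have h := tsum_binomZ_mul γ 0 r
  have h' := tsum_binomZ_mul γ r 0
  rw [sub_zero] at h
  rw [zero_sub] at h'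
  rw [← h, ← h']
  exact tsum_congr fun k => mul_comm _ _

/-! ## Matrix elements of products of two charged fields -/

/-- Replaces the normal ordering index `i` by the indices `c = P - i` and `c' = Q - i` of the E⁺
modes that remain. Energy bounds these by `R`, so the new ranges depend on neither `P` nor `Q`. -/
theorem sum_range_eq_sum_range {a : ℤ → ℂ} {g : ℤ → ℤ → ℂ} {P Q : ℤ} {R M : ℕ}
    (ha : ∀ k < 0, a k = 0) (hg : ∀ c' c, c' < 0 ∨ (R : ℤ) ≤ c' → g c' c = 0)
    (hg' : ∀ c' c, c < 0 ∨ (R : ℤ) ≤ c → g c' c = 0) (hM : P < M) :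
    ∑ i ∈ Finset.range M, a i * g (Q - i) (P - i) =
      ∑ c ∈ Finset.range R, ∑ c' ∈ Finset.range R,
        if P - c = Q - c' then a (P - c) * g c' c else 0 := by
  have hcast : ∀ (f : ℤ → ℂ) (n : ℕ), (∀ k, k < 0 ∨ (n : ℤ) ≤ k → f k = 0) →
      ∑ᶠ k, f k = ∑ i ∈ Finset.range n, f i := by
    intro f n hf
    rw [finsum_eq_sum_of_support_subset (s := (Finset.range n).map Nat.castEmbedding),
      Finset.sum_map]
    · rfl
    · intro k hk
      have : ¬ (k < 0 ∨ (n : ℤ) ≤ k) := fun h => hk (hf k h)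
      simp only [Finset.coe_map, Set.mem_image, Finset.mem_coe, Finset.mem_range]
      exact ⟨k.toNat, by omega, by simp; omega⟩
  have e1 : ∀ c ∈ Finset.range R, (∑ c' ∈ Finset.range R,
      if P - c = Q - c' then a (P - c) * g c' c else 0) = a (P - c) * g (Q - (P - c)) c := by
    intro c _
    rw [← hcast (fun c' => if P - c = Q - c' then a (P - c) * g c' c else 0) R]
    · rw [finsum_eq_single _ (Q - (P - c)), if_pos (by ring)]
      intro c' hc'
      rw [if_neg (by omega)]
    · intro k hk
      rw [hg k c hk, mul_zero, ite_self]
  rw [Finset.sum_congr rfl e1, ← hcast (fun i => a i * g (Q - i) (P - i)) M,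
    ← hcast (fun c => a (P - c) * g (Q - (P - c)) c) R, ← finsum_comp_equiv (Equiv.subLeft P)]
  · simp
  · intro k hk
    rw [hg' _ k hk, mul_zero]
  · intro k hk
    rcases hk with hk | hk
    · rw [ha k hk, zero_mul]
    · rw [hg' _ _ (Or.inl (by omega)), mul_zero]

/-- The indices `((q, c), (q', c'))`, all less than `R`. -/
def box (R : ℕ) : Finset ((ℕ × ℕ) × (ℕ × ℕ)) :=
  (Finset.range R ×ˢ Finset.range R) ×ˢ (Finset.range R ×ˢ Finset.range R)

/-- The matrix elements of the normally ordered products of two charged fields. -/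
def wick (α₁ α₂ : ℝ) (ν μ : Occ) (e : ℤ) (x : (ℕ × ℕ) × (ℕ × ℕ)) : ℂ :=
  if (x.1.1 : ℤ) - x.1.2 + (x.2.2 - x.2.1) = e then
    inner ℂ (embed0 (Ep (-α₂) x.2.2 (Ep α₁ x.1.1 (ket ν))))
      (embed0 (Ep (-α₁) x.1.2 (Ep α₂ x.2.1 (ket μ))))
  else 0

/-- E⁻(α₁) passes to the right as E⁺(-α₁), is normally ordered with E⁻(α₂), and E⁻(α₂) passes back
to the left as E⁺(-α₂). Afterwards only operators that lower the energy act, so the sum is finite,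
and `N` occurs only in the argument of `binomZ`. -/
theorem inner_V_V (α₁ α₂ : ℝ) {ν μ : Occ} {R : ℕ} (hν : energy ν < R) (hμ : energy μ < R)
    (N e : ℤ) :
    inner ℂ (embed0 (V α₁ N (ket ν))) (embed0 (V α₂ (N + e) (ket μ))) =
      ∑ x ∈ box R, wick α₁ α₂ ν μ e x * binomZ (-α₁ * α₂) (N + (x.1.1 - x.1.2)) := by
  have h1 : ∀ q q' : ℕ, inner ℂ (embed0 (Em α₁ (N + q) (Ep α₁ q (ket ν))))
      (embed0 (Em α₂ (N + e + q') (Ep α₂ q' (ket μ)))) =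
      ∑ c ∈ Finset.range R, ∑ c' ∈ Finset.range R,
        wick α₁ α₂ ν μ e ((q, c), (q', c')) * binomZ (-α₁ * α₂) (N + (q - c)) := by
    intro q q'
    obtain ⟨M, hM⟩ : ∃ M : ℕ, N + q < M := ⟨(N + q).toNat + 1, by omega⟩
    have e1 := congrArg (fun A => A (Ep α₂ q' (ket μ))) (Ep_mul_Em (-α₁) α₂ (N + q) (N + e + q') hM)
    simp only [Module.End.mul_apply, LinearMap.sum_apply, LinearMap.smul_apply] at e1
    rw [isAdj_Em, e1, map_sum, inner_sum]
    have e2 : ∀ i ∈ Finset.range M, inner ℂ (embed0 (Ep α₁ q (ket ν)))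
        (embed0 ((binom (-α₁ * α₂) i : ℂ) • (Em α₂ (N + e + q' - i)
          (Ep (-α₁) (N + q - i) (Ep α₂ q' (ket μ)))))) =
        binomZ (-α₁ * α₂) i * inner ℂ (embed0 (Ep (-α₂) (N + e + q' - i) (Ep α₁ q (ket ν))))
          (embed0 (Ep (-α₁) (N + q - i) (Ep α₂ q' (ket μ)))) := by
      intro i _
      rw [map_smul, inner_smul_right, ← (isAdj_Em α₂ _).symm]
      simp [binomZ]
    rw [Finset.sum_congr rfl e2, sum_range_eq_sum_range
      (a := binomZ (-α₁ * α₂)) (g := fun c' c => inner ℂ (embed0 (Ep (-α₂) c' (Ep α₁ q (ket ν))))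
          (embed0 (Ep (-α₁) c (Ep α₂ q' (ket μ))))) (P := N + q) (Q := N + e + q') (R := R)
          (M := M) _ _ _ hM]
    · refine Finset.sum_congr rfl fun c _ => Finset.sum_congr rfl fun c' _ => ?_
      unfold wick
      by_cases h : N + q - c = N + e + q' - c'
      · rw [if_pos h, if_pos (by dsimp only; omega), mul_comm, add_sub_assoc]
      · rw [if_neg h, if_neg (by dsimp only; omega), zero_mul]
    · intro k hk
      rw [binomZ, if_neg (by omega)]
    · intro c' c hc
      rcases hc with hc | hc
      · simp [Ep_of_neg _ hc]
      · simp [Ep_Ep_ket_eq_zero (-α₂) α₁ (ν := ν) (p := q) (q := c') (by omega) (by omega)]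
    · intro c' c hc
      rcases hc with hc | hc
      · simp [Ep_of_neg _ hc]
      · simp [Ep_Ep_ket_eq_zero (-α₁) α₂ (ν := μ) (p := q') (q := c) (by omega) (by omega)]
  rw [V_ket α₁ N hν, V_ket α₂ (N + e) hμ, map_sum, map_sum, sum_inner]
  simp only [inner_sum, h1]
  rw [box, Finset.sum_product, Finset.sum_product]
  refine Finset.sum_congr rfl fun q _ => ?_
  rw [Finset.sum_comm]
  refine (Finset.sum_congr rfl fun c _ => ?_).symm
  rw [Finset.sum_product]

/-- Coefficients of E⁺ commute, so normally ordered matrix elements do not depend on the order of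
the fields. -/
theorem wick_swap (α₁ α₂ : ℝ) (ν μ : Occ) (e : ℤ) (q c q' c' : ℕ) :
    wick (-α₂) (-α₁) ν μ e ((c', q'), (c, q)) = wick α₁ α₂ ν μ e ((q, c), (q', c')) := by
  unfold wick
  dsimp only
  have h1 := congrArg (fun A => A (ket ν)) (commute_Ep (-α₂) α₁ c' q).eq
  have h2 := congrArg (fun A => A (ket μ)) (commute_Ep (-α₁) α₂ c q').eq
  simp only [Module.End.mul_apply] at h1 h2
  rw [neg_neg, neg_neg, h1, h2]
  congr 1
  rw [add_comm]

/-- The involution of the indices that corresponds to the exchange of two charged fields. -/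
def boxSwap : (ℕ × ℕ) × (ℕ × ℕ) ≃ (ℕ × ℕ) × (ℕ × ℕ) where
  toFun x := ((x.2.2, x.2.1), (x.1.2, x.1.1))
  invFun x := ((x.2.2, x.2.1), (x.1.2, x.1.1))
  left_inv _ := rfl
  right_inv _ := rfl

/-- All dependence on `N` sits in products of two shifted binomial coefficients, one for each tensor
factor. Summed over `N` they depend only on the difference of the shifts. -/
theorem hasSum_inner_V_V {α₁ α₂ : ℝ} (hγ : -(1 / 2) < -α₁ * α₂) (ν₁ ν₂ μ₁ μ₂ : Occ)
    {R : ℕ} (h₁ : energy ν₁ < R) (h₂ : energy ν₂ < R) (h₃ : energy μ₁ < R)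
    (h₄ : energy μ₂ < R) (e m : ℤ) :
    HasSum (fun N : ℤ => inner ℂ (embed0 (V α₁ N (ket ν₁))) (embed0 (V α₂ (N + e) (ket ν₂))) *
      inner ℂ (embed0 (V α₁ (N + m) (ket μ₁))) (embed0 (V α₂ (N + m + e) (ket μ₂))))
      (∑ x ∈ box R, ∑ y ∈ box R, wick α₁ α₂ ν₁ ν₂ e x * wick α₁ α₂ μ₁ μ₂ e y *
        corr (-α₁ * α₂) (m + ((y.1.1 : ℤ) - y.1.2) - (x.1.1 - x.1.2))) := by
  simp only [inner_V_V α₁ α₂ h₁ h₂, inner_V_V α₁ α₂ h₃ h₄, Finset.sum_mul_sum]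
  refine hasSum_sum fun x _ => hasSum_sum fun y _ => ?_
  have h := (summable_binomZ_mul hγ ((x.1.1 : ℤ) - x.1.2) (m + ((y.1.1 : ℤ) - y.1.2))).hasSum.mul_left
    (wick α₁ α₂ ν₁ ν₂ e x * wick α₁ α₂ μ₁ μ₂ e y)
  rw [tsum_binomZ_mul] at h
  refine h.congr_fun fun N => ?_
  rw [← add_assoc N m]
  ring

/-- Locality of the charged fields at time zero. -/
theorem tsum_inner_V_V_swap {α₁ α₂ : ℝ} (hγ : -(1 / 2) < -α₁ * α₂) (ν₁ ν₂ μ₁ μ₂ : Occ)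
    (e m : ℤ) :
    ∑' N : ℤ, inner ℂ (embed0 (V α₁ N (ket ν₁))) (embed0 (V α₂ (N + e) (ket ν₂))) *
      inner ℂ (embed0 (V α₁ (N + m) (ket μ₁))) (embed0 (V α₂ (N + m + e) (ket μ₂))) =
    ∑' N : ℤ, inner ℂ (embed0 (V (-α₂) N (ket ν₁))) (embed0 (V (-α₁) (N + e) (ket ν₂))) *
      inner ℂ (embed0 (V (-α₂) (N + -m) (ket μ₁))) (embed0 (V (-α₁) (N + -m + e) (ket μ₂))) := by
  have hγ' : -(-α₂) * -α₁ = -α₁ * α₂ := by ring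
  obtain ⟨R, h₁, h₂, h₃, h₄⟩ : ∃ R, energy ν₁ < R ∧ energy ν₂ < R ∧ energy μ₁ < R ∧ energy μ₂ < R :=
    ⟨energy ν₁ + energy ν₂ + energy μ₁ + energy μ₂ + 1, by omega, by omega, by omega, by omega⟩
  rw [(hasSum_inner_V_V hγ ν₁ ν₂ μ₁ μ₂ h₁ h₂ h₃ h₄ e m).tsum_eq,
    (hasSum_inner_V_V (hγ'.symm ▸ hγ) ν₁ ν₂ μ₁ μ₂ h₁ h₂ h₃ h₄ e (-m)).tsum_eq, hγ']
  have hbox : ∀ x, x ∈ box R ↔ boxSwap x ∈ box R := by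
    intro x
    simp only [box, boxSwap, Finset.mem_product, Finset.mem_range, Equiv.coe_fn_mk]
    tauto
  refine Finset.sum_equiv boxSwap hbox fun x _ => Finset.sum_equiv boxSwap hbox fun y _ => ?_
  obtain ⟨⟨q, c⟩, q', c'⟩ := x
  obtain ⟨⟨k, d⟩, k', d'⟩ := y
  simp only [boxSwap, Equiv.coe_fn_mk]
  rw [wick_swap, wick_swap]
  -- Where both weights are nonzero, the swap replaces q - c by e - (q - c) and k - d by e - (k -
  -- d). The `e` cancels in the argument of `corr`, which just changes sign.
  by_cases hx : (q : ℤ) - c + (c' - q') = e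
  · by_cases hy : (k : ℤ) - d + (d' - k') = e
    · rw [← corr_neg]
      congr 2
      omega
    · simp [wick, hy]
  · simp [wick, hx]

/-! ## Finite vectors of the two-dimensional theory -/

theorem twoFin_induction {P : TwoFin → Prop} (Ψ : TwoFin) (zero : P 0)
    (add : ∀ x y, P x → P y → P (x + y)) (smul : ∀ (c : ℂ) x, P x → P (c • x))
    (ket : ∀ j ν μ, P (Finsupp.single j (ket ν ⊗ₜ ket μ))) : P Ψ := by
  induction Ψ using Finsupp.induction_linear with
  | zero => exact zero
  | add f g hf hg => exact add f g hf hg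
  | single j t =>
    induction t using TensorProduct.induction_on with
    | zero => rw [Finsupp.single_zero]; exact zero
    | add s t hs ht => rw [Finsupp.single_add]; exact add _ _ hs ht
    | tmul x y =>
      induction x using ket_induction with
      | zero => rw [TensorProduct.zero_tmul, Finsupp.single_zero]; exact zero
      | add x x' h h' => rw [TensorProduct.add_tmul, Finsupp.single_add]; exact add _ _ h h'
      | smul c x h => rw [← TensorProduct.smul_tmul', ← Finsupp.smul_single]; exact smul _ _ h
      | ket ν =>
        induction y using ket_induction with
        | zero => rw [TensorProduct.tmul_zero, Finsupp.single_zero]; exact zero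
        | add x x' h h' => rw [TensorProduct.tmul_add, Finsupp.single_add]; exact add _ _ h h'
        | smul c x h => rw [TensorProduct.tmul_smul, ← Finsupp.smul_single]; exact smul _ _ h
        | ket μ => exact ket j ν μ

theorem twoFin_ext {E : Type*} [AddCommMonoid E] [Module ℂ E] {A B : TwoFin →ₗ[ℂ] E}
    (h : ∀ j x y, A (Finsupp.single j (x ⊗ₜ y)) = B (Finsupp.single j (x ⊗ₜ y))) : A = B := by
  ext j x y
  exact h j x y

theorem embed_single_tmul (j : ℤ) (x y : SecFin) : embed (Finsupp.single j (x ⊗ₜ y)) =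
    lp.single 2 j ((embed0 x ⊗ₜ[ℂ] embed0 y : SecHil ⊗[ℂ] SecHil) : TwoSec) := by
  rw [embed, Finsupp.lsum_single]
  rfl

theorem inner_embed_single (j j' : ℤ) (x y x' y' : SecFin) :
    inner ℂ (embed (Finsupp.single j (x ⊗ₜ y))) (embed (Finsupp.single j' (x' ⊗ₜ y'))) =
      if j = j' then inner ℂ (embed0 x) (embed0 x') * inner ℂ (embed0 y) (embed0 y') else 0 := by
  rw [embed_single_tmul, embed_single_tmul, lp.inner_single_left, lp.single_apply]
  split_ifs with h
  · subst h
    simp [UniformSpace.Completion.inner_coe, TensorProduct.inner_tmul]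
  · simp [h]

/-- The sesquilinear form `⟨X Φ, Y Ψ⟩`. -/
def sesq (X Y : TwoFin →ₗ[ℂ] TwoHil) : TwoFin →ₗ⋆[ℂ] TwoFin →ₗ[ℂ] ℂ :=
  LinearMap.mk₂'ₛₗ (starRingEnd ℂ) (RingHom.id ℂ) (fun Φ Ψ => inner ℂ (X Φ) (Y Ψ))
    (fun _ _ _ => by rw [map_add, inner_add_left])
    (fun _ _ _ => by rw [map_smul, inner_smul_left]; rfl)
    (fun _ _ _ => by rw [map_add, inner_add_right])
    (fun _ _ _ => by rw [map_smul, inner_smul_right]; rfl)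

@[simp] theorem sesq_apply (X Y : TwoFin →ₗ[ℂ] TwoHil) (Φ Ψ : TwoFin) :
    sesq X Y Φ Ψ = inner ℂ (X Φ) (Y Ψ) := rfl

theorem sesq_ext {F G : TwoFin →ₗ⋆[ℂ] TwoFin →ₗ[ℂ] ℂ}
    (h : ∀ j ν μ j' ν' μ', F (Finsupp.single j (ket ν ⊗ₜ ket μ))
      (Finsupp.single j' (ket ν' ⊗ₜ ket μ')) = G (Finsupp.single j (ket ν ⊗ₜ ket μ))
      (Finsupp.single j' (ket ν' ⊗ₜ ket μ'))) : F = G := by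
  refine LinearMap.ext fun Φ => ?_
  induction Φ using twoFin_induction with
  | zero => simp
  | add x y hx hy => rw [map_add, map_add, hx, hy]
  | smul c x hx => rw [LinearMap.map_smulₛₗ, LinearMap.map_smulₛₗ, hx]
  | ket j ν μ =>
    refine LinearMap.ext fun Ψ => ?_
    induction Ψ using twoFin_induction with
    | zero => simp
    | add x y hx hy => rw [map_add, map_add, hx, hy]
    | smul c x hx => rw [map_smul, map_smul, hx]
    | ket j' ν' μ' => exact h j ν μ j' ν' μ'

/-- `B` is a formal adjoint of `A` on the finite vectors. -/
def IsAdjTwo (A B : TwoFin →ₗ[ℂ] TwoFin) : Prop :=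
  ∀ Φ Ψ, inner ℂ (embed (A Φ)) (embed Ψ) = inner ℂ (embed Φ) (embed (B Ψ))

theorem isAdjTwo_of_single {A B : TwoFin →ₗ[ℂ] TwoFin}
    (h : ∀ j x y j' x' y', inner ℂ (embed (A (Finsupp.single j (x ⊗ₜ y))))
        (embed (Finsupp.single j' (x' ⊗ₜ y'))) = inner ℂ (embed (Finsupp.single j (x ⊗ₜ y)))
        (embed (B (Finsupp.single j' (x' ⊗ₜ y'))))) : IsAdjTwo A B := by
  have := sesq_ext (F := sesq (embed ∘ₗ A) embed) (G := sesq embed (embed ∘ₗ B))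
    fun j ν μ j' ν' μ' => h j _ _ j' _ _
  exact fun Φ Ψ => congrArg (fun F : TwoFin →ₗ⋆[ℂ] TwoFin →ₗ[ℂ] ℂ => F Φ Ψ) this

theorem LLeft_single (α₀ : ℝ) (m j : ℤ) (x y : SecFin) :
    LLeft α₀ m (Finsupp.single j (x ⊗ₜ y)) = Finsupp.single j (L (j * α₀) m x ⊗ₜ y) := by
  simp [LLeft]

theorem LRight_single (α₀ : ℝ) (m j : ℤ) (x y : SecFin) :
    LRight α₀ m (Finsupp.single j (x ⊗ₜ y)) = Finsupp.single j (x ⊗ₜ L (j * α₀) m y) := by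
  simp [LRight]

theorem isAdjTwo_LLeft (α₀ : ℝ) (m : ℤ) : IsAdjTwo (LLeft α₀ m) (LLeft α₀ (-m)) := by
  refine isAdjTwo_of_single fun j x y j' x' y' => ?_
  rw [LLeft_single, LLeft_single, inner_embed_single, inner_embed_single]
  split_ifs with h
  · rw [h, isAdj_L _ m]
  · rfl

theorem isAdjTwo_LRight (α₀ : ℝ) (m : ℤ) : IsAdjTwo (LRight α₀ m) (LRight α₀ (-m)) := by
  refine isAdjTwo_of_single fun j x y j' x' y' => ?_
  rw [LRight_single, LRight_single, inner_embed_single, inner_embed_single]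
  split_ifs with h
  · rw [h, isAdj_L _ m]
  · rfl

/-- The free part of the Lorentz generators. -/
def freeGen (α₀ : ℝ) (m : ℤ) : TwoFin →ₗ[ℂ] TwoFin :=
  if m = 0 then LLeft α₀ 0 - LRight α₀ 0 else LLeft α₀ m + LRight α₀ (-m)

theorem isAdjTwo_freeGen (α₀ : ℝ) (m : ℤ) : IsAdjTwo (freeGen α₀ m) (freeGen α₀ (-m)) := by
  intro Φ Ψ
  unfold freeGen
  by_cases h : m = 0
  · subst h
    have h1 := isAdjTwo_LLeft α₀ 0 Φ Ψ
    have h2 := isAdjTwo_LRight α₀ 0 Φ Ψ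
    rw [neg_zero] at h1 h2
    simp only [neg_zero, if_true, LinearMap.sub_apply, map_sub, inner_sub_left, inner_sub_right,
      h1, h2]
  · rw [if_neg h, if_neg (by omega)]
    simp only [LinearMap.add_apply, map_add, inner_add_left, inner_add_right, isAdjTwo_LLeft α₀ m Φ,
      isAdjTwo_LRight α₀ (-m) Φ]

theorem freeGen_zero_single (α₀ : ℝ) (j : ℤ) (x y : SecFin) :
    freeGen α₀ 0 (Finsupp.single j (x ⊗ₜ y)) =
      Finsupp.single j (L (j * α₀) 0 x ⊗ₜ y - x ⊗ₜ L (j * α₀) 0 y) := by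
  rw [freeGen, if_pos rfl, LinearMap.sub_apply, LLeft_single, LRight_single, Finsupp.single_sub]

theorem freeGen_single (α₀ : ℝ) {m : ℤ} (hm : m ≠ 0) (j : ℤ) (x y : SecFin) :
    freeGen α₀ m (Finsupp.single j (x ⊗ₜ y)) =
      Finsupp.single j (L (j * α₀) m x ⊗ₜ y + x ⊗ₜ L (j * α₀) (-m) y) := by
  rw [freeGen, if_neg hm, LinearMap.add_apply, LLeft_single, LRight_single, Finsupp.single_add]

theorem LLeft_comp_LRight (α₀ : ℝ) (m n : ℤ) (Ψ : TwoFin) :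
    LLeft α₀ m (LRight α₀ n Ψ) = LRight α₀ n (LLeft α₀ m Ψ) := by
  have : LLeft α₀ m ∘ₗ LRight α₀ n = LRight α₀ n ∘ₗ LLeft α₀ m :=
    twoFin_ext fun j x y => by simp only [LinearMap.comp_apply, LLeft_single, LRight_single]
  exact congrArg (fun A : TwoFin →ₗ[ℂ] TwoFin => A Ψ) this

theorem LLeft_comp_LLeft (α₀ : ℝ) {m n : ℤ} {c : ℂ} {k : ℤ}
    (h : ∀ β, L β m * L β n = L β n * L β m + c • L β k) (Ψ : TwoFin) :
    LLeft α₀ m (LLeft α₀ n Ψ) = LLeft α₀ n (LLeft α₀ m Ψ) + c • LLeft α₀ k Ψ := by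
  have : LLeft α₀ m ∘ₗ LLeft α₀ n = LLeft α₀ n ∘ₗ LLeft α₀ m + c • LLeft α₀ k :=
    twoFin_ext fun j x y => by
      have h1 := congrArg (fun A => A x) (h (j * α₀))
      simp only [Module.End.mul_apply, LinearMap.add_apply, LinearMap.smul_apply] at h1
      simp only [LinearMap.comp_apply, LLeft_single, LinearMap.add_apply, LinearMap.smul_apply, h1,
        TensorProduct.add_tmul, Finsupp.single_add, ← TensorProduct.smul_tmul', Finsupp.smul_single]
  exact congrArg (fun A : TwoFin →ₗ[ℂ] TwoFin => A Ψ) this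

theorem LRight_comp_LRight (α₀ : ℝ) {m n : ℤ} {c : ℂ} {k : ℤ}
    (h : ∀ β, L β m * L β n = L β n * L β m + c • L β k) (Ψ : TwoFin) :
    LRight α₀ m (LRight α₀ n Ψ) = LRight α₀ n (LRight α₀ m Ψ) + c • LRight α₀ k Ψ := by
  have : LRight α₀ m ∘ₗ LRight α₀ n = LRight α₀ n ∘ₗ LRight α₀ m + c • LRight α₀ k :=
    twoFin_ext fun j x y => by
      have h1 := congrArg (fun A => A y) (h (j * α₀))
      simp only [Module.End.mul_apply, LinearMap.add_apply, LinearMap.smul_apply] at h1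
      simp only [LinearMap.comp_apply, LRight_single, LinearMap.add_apply, LinearMap.smul_apply, h1,
        TensorProduct.tmul_add, Finsupp.single_add, TensorProduct.tmul_smul, Finsupp.smul_single]
  exact congrArg (fun A : TwoFin →ₗ[ℂ] TwoFin => A Ψ) this

theorem L_zero_mul_L (β : ℝ) {n : ℤ} (hn : n = 1 ∨ n = -1) :
    L β 0 * L β n = L β n * L β 0 + (-(n : ℂ)) • L β n := by
  rcases hn with rfl | rfl
  · rw [L_zero_mul_L_one]; simp [sub_eq_add_neg]
  · rw [L_zero_mul_L_neg_one]; simp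

theorem freeGen_zero_comp (α₀ : ℝ) {n : ℤ} (hn : n = 1 ∨ n = -1) (Ψ : TwoFin) :
    freeGen α₀ 0 (freeGen α₀ n Ψ) = freeGen α₀ n (freeGen α₀ 0 Ψ) - (n : ℂ) • freeGen α₀ n Ψ := by
  have h0 : n ≠ 0 := by omega
  have h1 := LLeft_comp_LLeft α₀ (fun β => L_zero_mul_L β hn) Ψ
  have h2 := LRight_comp_LRight α₀ (fun β => L_zero_mul_L β (n := -n) (by omega)) Ψ
  simp only [freeGen, if_true, if_neg h0, LinearMap.sub_apply, LinearMap.add_apply, map_add,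
    map_sub, h1, h2, LLeft_comp_LRight]
  push_cast
  module

/-- The second tensor factor carries the modes in reversed order and contributes -2 L₀, hence the
difference in 𝔩₀. -/
theorem freeGen_one_comp_neg_one (α₀ : ℝ) (Ψ : TwoFin) :
    freeGen α₀ 1 (freeGen α₀ (-1) Ψ) =
      freeGen α₀ (-1) (freeGen α₀ 1 Ψ) + (2 : ℂ) • freeGen α₀ 0 Ψ := by
  have h1 := LLeft_comp_LLeft α₀ (fun β => L_one_mul_L_neg_one β) Ψ
  have h2 := LRight_comp_LRight α₀ (fun β => L_one_mul_L_neg_one β) Ψ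
  simp only [freeGen, if_true, if_neg (show (1 : ℤ) ≠ 0 by decide),
    if_neg (show (-1 : ℤ) ≠ 0 by decide), LinearMap.sub_apply, LinearMap.add_apply, map_add,
    h1, h2, LLeft_comp_LRight, neg_neg]
  module

/-! ## The modes of the product field -/

/-- The operator `V_N ⊗ V_{N'}` of charge `r α₀`. -/
def VV (α₀ : ℝ) (r N N' : ℤ) : TwoFin →ₗ[ℂ] TwoFin :=
  Finsupp.lsum ℂ fun j : ℤ =>
    Finsupp.lsingle (j + r) ∘ₗ TensorProduct.map (V (r * α₀) N) (V (r * α₀) N')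

theorem VV_single (α₀ : ℝ) (r N N' j : ℤ) (x y : SecFin) :
    VV α₀ r N N' (Finsupp.single j (x ⊗ₜ y)) =
      Finsupp.single (j + r) (V (r * α₀) N x ⊗ₜ V (r * α₀) N' y) := by
  simp [VV]

theorem isAdjTwo_VV (α₀ : ℝ) (r N N' : ℤ) :
    IsAdjTwo (VV α₀ r N N') (VV α₀ (-r) (-N) (-N')) := by
  refine isAdjTwo_of_single fun j x y j' x' y' => ?_
  rw [VV_single, VV_single, inner_embed_single, inner_embed_single]
  by_cases h : j + r = j'
  · rw [if_pos h, if_pos (by omega), isAdj_V, isAdj_V]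
    push_cast
    rw [neg_mul]
  · rw [if_neg h, if_neg (by omega)]

theorem freeGen_zero_comp_VV (α₀ : ℝ) (r N N' : ℤ) (Ψ : TwoFin) :
    freeGen α₀ 0 (VV α₀ r N N' Ψ) =
      VV α₀ r N N' (freeGen α₀ 0 Ψ) + ((N : ℂ) - N') • VV α₀ r N N' Ψ := by
  have : freeGen α₀ 0 ∘ₗ VV α₀ r N N' =
      VV α₀ r N N' ∘ₗ freeGen α₀ 0 + ((N : ℂ) - N') • VV α₀ r N N' :=
    twoFin_ext fun j x y => by
      have h1 := congrArg (fun A => A x) (L_zero_mul_V_charge (r * α₀) (j * α₀) N)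
      have h2 := congrArg (fun A => A y) (L_zero_mul_V_charge (r * α₀) (j * α₀) N')
      rw [← add_mul] at h1 h2
      simp only [Module.End.mul_apply, LinearMap.add_apply, LinearMap.smul_apply] at h1 h2
      simp only [LinearMap.comp_apply, VV_single, freeGen_zero_single, LinearMap.add_apply,
        LinearMap.smul_apply, Int.cast_add, h1, h2, Finsupp.single_sub, map_sub]
      simp only [TensorProduct.add_tmul, TensorProduct.tmul_add, TensorProduct.tmul_smul,
        ← TensorProduct.smul_tmul', Finsupp.single_add, ← Finsupp.smul_single]
      module
  exact congrArg (fun A : TwoFin →ₗ[ℂ] TwoFin => A Ψ) this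

theorem freeGen_one_comp_VV (α₀ : ℝ) (r N N' j : ℤ) (x y : SecFin) :
    freeGen α₀ 1 (VV α₀ r N N' (Finsupp.single j (x ⊗ₜ y))) =
      VV α₀ r N N' (freeGen α₀ 1 (Finsupp.single j (x ⊗ₜ y))) +
      ((N : ℂ) - 1 + ((r * α₀ : ℝ) : ℂ) ^ 2 + ((r * α₀ : ℝ) : ℂ) * ((j * α₀ : ℝ) : ℂ)) •
        VV α₀ r (N - 1) N' (Finsupp.single j (x ⊗ₜ y)) +
      ((N' : ℂ) + 1 + ((r * α₀ : ℝ) : ℂ) * ((j * α₀ : ℝ) : ℂ)) •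
        VV α₀ r N (N' + 1) (Finsupp.single j (x ⊗ₜ y)) := by
  have h1 := congrArg (fun A => A x) (L_one_mul_V (r * α₀) (j * α₀) N)
  have h2 := congrArg (fun A => A y) (L_neg_one_mul_V (r * α₀) (j * α₀) N')
  rw [← add_mul] at h1 h2
  simp only [Module.End.mul_apply, LinearMap.add_apply, LinearMap.smul_apply] at h1 h2
  simp only [VV_single, freeGen_single α₀ one_ne_zero, Int.cast_add, h1, h2, Finsupp.single_add,
    map_add]
  simp only [TensorProduct.add_tmul, TensorProduct.tmul_add, TensorProduct.tmul_smul,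
    ← TensorProduct.smul_tmul', Finsupp.single_add, ← Finsupp.smul_single]
  abel

theorem freeGen_neg_one_comp_VV (α₀ : ℝ) (r N N' j : ℤ) (x y : SecFin) :
    freeGen α₀ (-1) (VV α₀ r N N' (Finsupp.single j (x ⊗ₜ y))) =
      VV α₀ r N N' (freeGen α₀ (-1) (Finsupp.single j (x ⊗ₜ y))) +
      ((N : ℂ) + 1 + ((r * α₀ : ℝ) : ℂ) * ((j * α₀ : ℝ) : ℂ)) •
        VV α₀ r (N + 1) N' (Finsupp.single j (x ⊗ₜ y)) +
      ((N' : ℂ) - 1 + ((r * α₀ : ℝ) : ℂ) ^ 2 + ((r * α₀ : ℝ) : ℂ) * ((j * α₀ : ℝ) : ℂ)) •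
        VV α₀ r N (N' - 1) (Finsupp.single j (x ⊗ₜ y)) := by
  have h1 := congrArg (fun A => A x) (L_neg_one_mul_V (r * α₀) (j * α₀) N)
  have h2 := congrArg (fun A => A y) (L_one_mul_V (r * α₀) (j * α₀) N')
  rw [← add_mul] at h1 h2
  simp only [Module.End.mul_apply, LinearMap.add_apply, LinearMap.smul_apply] at h1 h2
  simp only [VV_single, freeGen_single α₀ (show (-1 : ℤ) ≠ 0 by decide), neg_neg, Int.cast_add, h1,
    h2, Finsupp.single_add, map_add]
  simp only [TensorProduct.add_tmul, TensorProduct.tmul_add, TensorProduct.tmul_smul,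
    ← TensorProduct.smul_tmul', Finsupp.single_add, ← Finsupp.smul_single]
  abel

/-! ## Density of the finite vectors -/

theorem mem_topologicalClosure_of_hasSum {ι E : Type*} [NormedAddCommGroup E] [NormedSpace ℂ E]
    {S : Submodule ℂ E} {f : ι → E} {x : E} (h : HasSum f x)
    (hf : ∀ i, f i ∈ S.topologicalClosure) : x ∈ S.topologicalClosure :=
  S.isClosed_topologicalClosure.mem_of_tendsto h
    (Filter.Eventually.of_forall fun _ => Submodule.sum_mem _ fun i _ => hf i)

theorem denseRange_embed0 : DenseRange embed0 := by
  intro x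
  have h := mem_topologicalClosure_of_hasSum (S := LinearMap.range embed0)
    (lp.hasSum_single (p := 2) (by simp) x) fun ν => by
      refine Submodule.le_topologicalClosure _ ⟨x ν • ket ν, ?_⟩
      rw [map_smul, embed0_ket, ← lp.single_smul, smul_eq_mul, mul_one]
  exact h

theorem continuous_tmul_left (y : SecHil) : Continuous fun x : SecHil => x ⊗ₜ[ℂ] y :=
  ((TensorProduct.mk ℂ SecHil SecHil).flip y).mkContinuous ‖y‖ (fun x => by
    simp [mul_comm]) |>.continuous

theorem continuous_tmul_right (x : SecHil) : Continuous fun y : SecHil => x ⊗ₜ[ℂ] y :=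
  (TensorProduct.mk ℂ SecHil SecHil x).mkContinuous ‖x‖ (fun y => by simp) |>.continuous

theorem denseRange_embedTensor : DenseRange embedTensor := by
  have h1 : ∀ x y : SecHil, ((x ⊗ₜ[ℂ] y : SecHil ⊗[ℂ] SecHil) : TwoSec) ∈
      (LinearMap.range embedTensor).topologicalClosure := by
    intro x y
    have hc := (LinearMap.range embedTensor).isClosed_topologicalClosure
    induction x using denseRange_embed0.induction_on with
    | hp =>
      exact hc.preimage ((UniformSpace.Completion.continuous_coe _).comp (continuous_tmul_left y))
    | ih x =>
      induction y using denseRange_embed0.induction_on with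
      | hp =>
        exact hc.preimage ((UniformSpace.Completion.continuous_coe _).comp (continuous_tmul_right _))
      | ih y => exact Submodule.le_topologicalClosure _ ⟨x ⊗ₜ y, rfl⟩
  have h2 : ∀ t : SecHil ⊗[ℂ] SecHil, (t : TwoSec) ∈
      (LinearMap.range embedTensor).topologicalClosure := by
    intro t
    induction t using TensorProduct.induction_on with
    | zero => exact Submodule.zero_mem _
    | add s t hs ht =>
      rw [UniformSpace.Completion.coe_add]
      exact Submodule.add_mem _ hs ht
    | tmul x y => exact h1 x y
  intro v
  induction v using UniformSpace.Completion.induction_on with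
  | hp => exact isClosed_closure
  | ih t => exact h2 t

theorem dense_finDomain : Dense (finDomain : Set TwoHil) := by
  have h1 : ∀ (j : ℤ) (v : TwoSec), lp.single 2 j v ∈ finDomain.topologicalClosure := by
    intro j v
    induction v using denseRange_embedTensor.induction_on with
    | hp =>
      exact finDomain.isClosed_topologicalClosure.preimage (lp.isometry_single j).continuous
    | ih t =>
      refine Submodule.le_topologicalClosure _ ⟨Finsupp.single j t, ?_⟩
      rw [embed, Finsupp.lsum_single]
      rfl
  intro x
  exact mem_topologicalClosure_of_hasSum (lp.hasSum_single (p := 2) (by simp) x) fun j => h1 j _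

/-! ## Convergence of the modes of the product field -/

/-- Some of the vectors may vanish, so the criterion is applied to the family of spans. -/
theorem summable_of_pairwise_inner_eq_zero {ι E : Type*} [NormedAddCommGroup E]
    [InnerProductSpace ℂ E] [CompleteSpace E] {f : ι → E}
    (h : Pairwise fun i j => inner ℂ (f i) (f j) = 0) (hf : Summable fun i => ‖f i‖ ^ 2) :
    Summable f := by
  have hV : OrthogonalFamily ℂ (fun i => (ℂ ∙ f i : Submodule ℂ E))
      fun i => (ℂ ∙ f i : Submodule ℂ E).subtypeₗᵢ := by
    intro i j hij v w
    obtain ⟨a, ha⟩ := Submodule.mem_span_singleton.1 v.2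
    obtain ⟨b, hb⟩ := Submodule.mem_span_singleton.1 w.2
    change inner ℂ (v : E) (w : E) = 0
    rw [← ha, ← hb, inner_smul_left, inner_smul_right, h hij, mul_zero, mul_zero]
  exact (hV.summable_iff_norm_sq_summable fun i => ⟨f i, Submodule.mem_span_singleton_self _⟩).2 hf

/-- The exponent is ∓α². The bound |α| < 1/√2 enters the proof only here. -/
theorem neg_half_lt {α₀ : ℝ} {q : ℤ} (hα : |(q : ℝ) * α₀| < 1 / Real.sqrt 2) (ε₁ ε₂ : ℤˣ) :
    -(1 / 2) < -(((ε₁ : ℤ) * q : ℤ) * α₀) * ((((ε₂ : ℤ) * q : ℤ) : ℝ) * α₀) := by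
  have h : ((q : ℝ) * α₀) ^ 2 < 1 / 2 := by
    have := pow_lt_pow_left₀ hα (abs_nonneg _) two_ne_zero
    rwa [sq_abs, div_pow, one_pow, Real.sq_sqrt zero_le_two] at this
  have h0 := sq_nonneg ((q : ℝ) * α₀)
  rcases Int.units_eq_one_or ε₁ with rfl | rfl <;> rcases Int.units_eq_one_or ε₂ with rfl | rfl <;>
    push_cast <;> nlinarith

/-- Convergence of the modes of the product field on the finite vectors. -/
def ModesSummable (α₀ : ℝ) (q : ℤ) : Prop :=
  ∀ (ε : ℤˣ) (n : ℤ) (Ψ : TwoFin), Summable fun N => embed (VV α₀ (ε * q) N (N + n) Ψ)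

/-- For different `N` the first tensor factors have different energies, so the terms are orthogonal.
Their squared norms form the series of `hasSum_inner_V_V` with equal charges and `e = 0`. -/
theorem modesSummable {α₀ : ℝ} {q : ℤ} (hα : |(q : ℝ) * α₀| < 1 / Real.sqrt 2) :
    ModesSummable α₀ q := by
  intro ε n Ψ
  induction Ψ using twoFin_induction with
  | zero => simp
  | add x y hx hy => simpa only [map_add] using hx.add hy
  | smul c x hx => simpa only [map_smul] using hx.const_smul c
  | ket j ν μ =>
    simp only [VV_single]
    refine summable_of_pairwise_inner_eq_zero (fun N N' hN => ?_) ?_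
    · beta_reduce
      rw [inner_embed_single, if_pos rfl, ((hasEnergy_ket ν).V _ N).inner_eq_zero
        ((hasEnergy_ket ν).V _ N') (by omega), zero_mul]
    · obtain ⟨R, h₁, h₂⟩ : ∃ R, energy ν < R ∧ energy μ < R :=
        ⟨energy ν + energy μ + 1, by omega, by omega⟩
      have h := (hasSum_inner_V_V (neg_half_lt hα ε ε) ν ν μ μ h₁ h₁ h₂ h₂ 0 n).summable
      rw [← Complex.summable_ofReal]
      refine h.congr fun N => ?_
      have h1 := inner_self_eq_norm_sq_to_K (𝕜 := ℂ) (embed (Finsupp.single (j + ε * q)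
        (V ((ε * q : ℤ) * α₀) N (ket ν) ⊗ₜ V ((ε * q : ℤ) * α₀) (N + n) (ket μ))))
      rw [inner_embed_single, if_pos rfl] at h1
      rw [add_zero, add_zero, h1]
      simp

variable {α₀ : ℝ} {q : ℤ}

/-- The modes of the product field on the finite vectors. -/
def productMode (h : ModesSummable α₀ q) (n : ℤ) : TwoFin →ₗ[ℂ] TwoHil where
  toFun Ψ := ∑ ε : ℤˣ, ∑' N, embed (VV α₀ (ε * q) N (N + n) Ψ)
  map_add' Φ Ψ := by
    rw [← Finset.sum_add_distrib]
    refine Finset.sum_congr rfl fun ε _ => ?_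
    rw [← (h ε n Φ).tsum_add (h ε n Ψ)]
    simp only [map_add]
  map_smul' c Ψ := by
    rw [Finset.smul_sum]
    refine Finset.sum_congr rfl fun ε _ => ?_
    rw [RingHom.id_apply, ← (h ε n Ψ).tsum_const_smul c]
    simp only [map_smul]

theorem productMode_apply (h : ModesSummable α₀ q) (n : ℤ) (Ψ : TwoFin) :
    productMode h n Ψ = ∑ ε : ℤˣ, ∑' N, embed (VV α₀ (ε * q) N (N + n) Ψ) := rfl

theorem inner_productMode_right (h : ModesSummable α₀ q) (n : ℤ) (x : TwoHil) (Ψ : TwoFin) :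
    inner ℂ x (productMode h n Ψ) =
      ∑ ε : ℤˣ, ∑' N, inner ℂ x (embed (VV α₀ (ε * q) N (N + n) Ψ)) := by
  rw [productMode_apply, inner_sum]
  exact Finset.sum_congr rfl fun ε _ => (innerSL ℂ x).map_tsum (h ε n Ψ)

theorem inner_tsum_left {ι E : Type*} [NormedAddCommGroup E] [InnerProductSpace ℂ E] {f : ι → E}
    (hf : Summable f) (x : E) : inner ℂ (∑' i, f i) x = ∑' i, inner ℂ (f i) x := by
  rw [← inner_conj_symm, ← innerSL_apply_apply ℂ x, (innerSL ℂ x).map_tsum hf, Complex.conj_tsum]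
  exact tsum_congr fun i => by rw [innerSL_apply_apply, inner_conj_symm]

theorem inner_productMode_left (h : ModesSummable α₀ q) (n : ℤ) (x : TwoHil) (Ψ : TwoFin) :
    inner ℂ (productMode h n Ψ) x =
      ∑ ε : ℤˣ, ∑' N, inner ℂ (embed (VV α₀ (ε * q) N (N + n) Ψ)) x := by
  rw [productMode_apply, sum_inner]
  exact Finset.sum_congr rfl fun ε _ => inner_tsum_left (h ε n Ψ) x

/-- Adjunction reverses the charge and both mode indices. The sums over `ε` and `N` are invariant
under these reflections. -/
theorem inner_productMode_embed (h : ModesSummable α₀ q) (n : ℤ) (Φ Ψ : TwoFin) :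
    inner ℂ (productMode h (-n) Φ) (embed Ψ) = inner ℂ (embed Φ) (productMode h n Ψ) := by
  rw [inner_productMode_left, inner_productMode_right, ← Equiv.sum_comp (Equiv.neg ℤˣ)]
  refine Finset.sum_congr rfl fun ε _ => ?_
  rw [← (Equiv.neg ℤ).tsum_eq]
  refine tsum_congr fun N => ?_
  rw [isAdjTwo_VV]
  simp [add_comm]

/-- The index `s` for which `Y_{α, s} = V_N` in the sector of charge `β`. -/
def modeIndex (α β : ℝ) (N : ℤ) : ℝ := -(α ^ 2 / 2) - α * β - N

theorem modeIndex_injective (α β : ℝ) : Function.Injective (modeIndex α β) := fun N N' h => by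
  simpa [modeIndex] using h

theorem Y_modeIndex (α β : ℝ) (N : ℤ) : Y α β (modeIndex α β N) = V α N :=
  Y_eq_V α β _ N rfl

theorem Y_add_modeIndex (α β : ℝ) (n N : ℤ) : Y α β (-(n : ℝ) + modeIndex α β N) = V α (N + n) :=
  Y_eq_V α β _ (N + n) (by rw [modeIndex]; push_cast; ring)

/-- The real index belonging to `N` depends on the sector, so the comparison is made on one summand
at a time. -/
theorem modeTerm_comp_lsingle (α₀ : ℝ) (q n j N : ℤ) (ε : ℤˣ) :
    modeTerm α₀ q n (modeIndex ((ε * q : ℤ) * α₀) (j * α₀) N, ε) ∘ₗ Finsupp.lsingle j =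
      VV α₀ (ε * q) N (N + n) ∘ₗ Finsupp.lsingle j := by
  ext x y : 3
  simp only [modeTerm, YY, VV, LinearMap.comp_apply, Finsupp.lsingle_apply, Finsupp.lsum_single,
    TensorProduct.AlgebraTensorModule.curry_apply, TensorProduct.curry_apply,
    LinearMap.coe_restrictScalars]
  rw [Y_modeIndex, Y_add_modeIndex]

theorem modeTerm_comp_lsingle_eq_zero (α₀ : ℝ) (q n j : ℤ) (p : ℝ × ℤˣ)
    (h : ∀ N, p.1 ≠ modeIndex ((p.2 * q : ℤ) * α₀) (j * α₀) N) :
    modeTerm α₀ q n p ∘ₗ Finsupp.lsingle j = 0 := by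
  ext x y : 3
  simp only [modeTerm, YY, LinearMap.comp_apply, Finsupp.lsingle_apply, Finsupp.lsum_single,
    TensorProduct.AlgebraTensorModule.curry_apply, TensorProduct.curry_apply,
    LinearMap.coe_restrictScalars]
  rw [Y_eq_zero _ _ _ h]
  simp

theorem countable_modeTerm_ne_zero (α₀ : ℝ) (q n j : ℤ) :
    {p : ℝ × ℤˣ | modeTerm α₀ q n p ∘ₗ Finsupp.lsingle j ≠ 0}.Countable := by
  refine (Set.countable_range fun x : ℤ × ℤˣ =>
    (modeIndex ((x.2 * q : ℤ) * α₀) (j * α₀) x.1, x.2)).mono fun p hp => ?_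
  by_contra h
  refine hp (modeTerm_comp_lsingle_eq_zero α₀ q n j p fun N hN => h ⟨(N, p.2), ?_⟩)
  exact Prod.ext hN.symm rfl

theorem hasSum_modeTerm (h : ModesSummable α₀ q) (n : ℤ) (Ψ : TwoFin) :
    HasSum (fun p => embed (modeTerm α₀ q n p Ψ)) (productMode h n Ψ) := by
  induction Ψ using Finsupp.induction_linear with
  | zero => simpa only [map_zero] using hasSum_zero
  | add f g hf hg => simpa only [map_add] using hf.add hg
  | single j t =>
    -- For each sign the nonzero terms lie on an injective image of ℤ, on which the real-indexed
    -- series is the one over `N`.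
    have h1 : ∀ ε : ℤˣ, HasSum (fun p : ℝ × ℤˣ =>
        if p.2 = ε then embed (modeTerm α₀ q n p (Finsupp.single j t)) else 0)
        (∑' N, embed (VV α₀ (ε * q) N (N + n) (Finsupp.single j t))) := by
      intro ε
      have hinj : Function.Injective
          fun N : ℤ => (modeIndex ((ε * q : ℤ) * α₀) (j * α₀) N, ε) := fun N N' hN =>
        modeIndex_injective _ _ (Prod.ext_iff.1 hN).1
      rw [← hinj.hasSum_iff]
      · refine (h ε n (Finsupp.single j t)).hasSum.congr_fun fun N => ?_
        simp only [Function.comp_apply, if_true]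
        exact congrArg embed (congrArg (fun A : _ →ₗ[ℂ] TwoFin => A t)
          (modeTerm_comp_lsingle α₀ q n j N ε))
      · rintro ⟨k, ε'⟩ hp
        by_cases hε : ε' = ε
        · subst hε
          rw [if_pos rfl]
          have := modeTerm_comp_lsingle_eq_zero α₀ q n j (k, ε') fun N hN =>
            hp ⟨N, Prod.ext hN.symm rfl⟩
          have := congrArg (fun A : _ →ₗ[ℂ] TwoFin => embed (A t)) this
          simpa using this
        · rw [if_neg hε]
    refine (hasSum_sum fun ε (_ : ε ∈ Finset.univ) => h1 ε).congr_fun fun p => ?_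
    simp only [Finset.sum_ite_eq, Finset.mem_univ, if_true]

/-! ## The Lorentz generators on the finite vectors -/

theorem onFinDomain_apply (A : TwoFin →ₗ[ℂ] TwoFin) (Ψ : TwoFin) (h : embed Ψ ∈ finDomain) :
    onFinDomain A ⟨embed Ψ, h⟩ = embed (A Ψ) := by
  have : finEquiv.symm ⟨embed Ψ, h⟩ = Ψ := (finEquiv.symm_apply_eq).2 (Subtype.ext rfl)
  simp [onFinDomain, this]

/-- The Lorentz generators as linear maps on the finite vectors. -/
def gen (h : ModesSummable α₀ q) (lam : ℂ) (m : ℤ) : TwoFin →ₗ[ℂ] TwoHil :=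
  embed ∘ₗ freeGen α₀ m + if m = 0 then 0 else lam • productMode h m

theorem gen_zero (h : ModesSummable α₀ q) (lam : ℂ) (Ψ : TwoFin) :
    gen h lam 0 Ψ = embed (freeGen α₀ 0 Ψ) := by
  simp [gen]

theorem gen_of_ne_zero (h : ModesSummable α₀ q) (lam : ℂ) {m : ℤ} (hm : m ≠ 0) (Ψ : TwoFin) :
    gen h lam m Ψ = embed (freeGen α₀ m Ψ) + lam • productMode h m Ψ := by
  simp [gen, hm]

theorem lorentzGen_domain_le (lam : ℂ) (m : ℤ) :
    (lorentzGen α₀ q lam m).domain ≤ finDomain := by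
  unfold lorentzGen
  split_ifs
  · exact le_rfl
  · exact inf_le_left

theorem lorentzGen_embed (h : ModesSummable α₀ q) (lam : ℂ) (m : ℤ) (Ψ : TwoFin) :
    ∃ hΨ : embed Ψ ∈ (lorentzGen α₀ q lam m).domain,
      lorentzGen α₀ q lam m ⟨embed Ψ, hΨ⟩ = gen h lam m Ψ := by
  have hD : embed Ψ ∈ finDomain := ⟨Ψ, rfl⟩
  unfold lorentzGen
  by_cases hm : m = 0
  · subst hm
    rw [if_pos rfl, gen_zero, freeGen, if_pos rfl]
    exact ⟨hD, onFinDomain_apply _ Ψ hD⟩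
  · rw [if_neg hm, gen_of_ne_zero h lam hm, freeGen, if_neg hm]
    have hs := hasSum_modeTerm h m Ψ
    simp only [← onFinDomain_apply _ Ψ hD] at hs
    refine ⟨⟨hD, hD, hs.summable⟩, ?_⟩
    rw [LinearPMap.add_apply, LinearPMap.smul_apply]
    congr 1
    · exact onFinDomain_apply _ Ψ hD
    · exact congrArg (lam • ·) hs.tsum_eq

/-- The generator with index `-m` and conjugate coupling is a formal adjoint; it supplies the values
of the adjoint on 𝒟. -/
theorem inner_gen_embed (h : ModesSummable α₀ q) (lam : ℂ) (m : ℤ) (Φ Ψ : TwoFin) :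
    inner ℂ (gen h (conj lam) (-m) Φ) (embed Ψ) = inner ℂ (embed Φ) (gen h lam m Ψ) := by
  by_cases hm : m = 0
  · subst hm
    rw [neg_zero, gen_zero, gen_zero, isAdjTwo_freeGen, neg_zero]
  · rw [gen_of_ne_zero _ _ hm, gen_of_ne_zero _ _ (neg_ne_zero.2 hm), inner_add_left,
      inner_add_right, isAdjTwo_freeGen, neg_neg, inner_smul_left, inner_smul_right,
      inner_productMode_embed, Complex.conj_conj]

theorem le_lorentzGen_domain (h : ModesSummable α₀ q) (lam : ℂ) (m : ℤ) :
    finDomain ≤ (lorentzGen α₀ q lam m).domain := by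
  rintro _ ⟨Ψ, rfl⟩
  exact (lorentzGen_embed h lam m Ψ).1

theorem lorentzGen_apply (h : ModesSummable α₀ q) (lam : ℂ) (m : ℤ) (Ψ : TwoFin)
    (hΨ : embed Ψ ∈ (lorentzGen α₀ q lam m).domain) :
    lorentzGen α₀ q lam m ⟨embed Ψ, hΨ⟩ = gen h lam m Ψ :=
  (lorentzGen_embed h lam m Ψ).2

theorem inner_gen_lorentzGen (h : ModesSummable α₀ q) (lam : ℂ) (m : ℤ) (Φ : TwoFin)
    (x : (lorentzGen α₀ q lam m).domain) :
    inner ℂ (gen h (conj lam) (-m) Φ) (x : TwoHil) =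
      inner ℂ (embed Φ) (lorentzGen α₀ q lam m x) := by
  obtain ⟨x, hx⟩ := x
  obtain ⟨Ψ, rfl⟩ := lorentzGen_domain_le lam m hx
  rw [lorentzGen_apply h, inner_gen_embed]

theorem le_adjoint_domain (h : ModesSummable α₀ q) (lam : ℂ) (m : ℤ) :
    finDomain ≤ (lorentzGen α₀ q lam m).adjoint.domain := by
  rintro _ ⟨Φ, rfl⟩
  exact LinearPMap.mem_adjoint_domain_of_exists _
    ⟨gen h (conj lam) (-m) Φ, inner_gen_lorentzGen h lam m Φ⟩

theorem adjoint_lorentzGen_apply (h : ModesSummable α₀ q) (lam : ℂ) (m : ℤ) (Φ : TwoFin)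
    (hΦ : embed Φ ∈ (lorentzGen α₀ q lam m).adjoint.domain) :
    (lorentzGen α₀ q lam m).adjoint ⟨embed Φ, hΦ⟩ = gen h (conj lam) (-m) Φ :=
  LinearPMap.adjoint_apply_eq (dense_finDomain.mono (le_lorentzGen_domain h lam m)) _
    (inner_gen_lorentzGen h lam m Φ)

/-- The weak commutation relations follow from those on the finite vectors. -/
theorem weakCommutator_of_inner_gen (h : ModesSummable α₀ q) (lam : ℂ) (m n : ℤ)
    (hc : ∀ Φ Ψ, inner ℂ (gen h (conj lam) (-m) Φ) (gen h lam n Ψ) -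
      inner ℂ (gen h (conj lam) (-n) Φ) (gen h lam m Ψ) =
      ((m : ℂ) - n) * inner ℂ (embed Φ) (gen h lam (m + n) Ψ)) :
    WeakCommutator finDomain (lorentzGen α₀ q lam m) (lorentzGen α₀ q lam n)
      (((m : ℂ) - (n : ℂ)) • lorentzGen α₀ q lam (m + n)) := by
  refine ⟨le_lorentzGen_domain h lam m, le_adjoint_domain h lam m, le_lorentzGen_domain h lam n,
    le_adjoint_domain h lam n, le_lorentzGen_domain h lam (m + n), ?_⟩
  rintro ⟨_, Φ, rfl⟩ ⟨_, Ψ, rfl⟩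
  rw [LinearPMap.smul_apply, inner_smul_right]
  simp only [lorentzGen_apply h, adjoint_lorentzGen_apply h]
  exact hc Φ Ψ

/-! ## The commutation relations on the finite vectors -/

theorem summable_inner {ι E : Type*} [NormedAddCommGroup E] [InnerProductSpace ℂ E] {f : ι → E}
    (hf : Summable f) (x : E) : Summable fun i => inner ℂ x (f i) :=
  (innerSL ℂ x).summable hf

/-- A product mode need not map finite vectors to finite vectors, so its commutator with the free
generator is taken weakly. Paired with a finite vector, it is the series of commutators of the
individual terms. -/
theorem inner_freeGen_productMode (h : ModesSummable α₀ q) (m n : ℤ) (Φ Ψ : TwoFin) :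
    inner ℂ (embed (freeGen α₀ (-m) Φ)) (productMode h n Ψ) -
      inner ℂ (productMode h (-n) Φ) (embed (freeGen α₀ m Ψ)) =
    ∑ ε : ℤˣ, ∑' N, inner ℂ (embed Φ)
      (embed (freeGen α₀ m (VV α₀ (ε * q) N (N + n) Ψ) -
        VV α₀ (ε * q) N (N + n) (freeGen α₀ m Ψ))) := by
  rw [inner_productMode_embed, inner_productMode_right, inner_productMode_right,
    ← Finset.sum_sub_distrib]
  refine Finset.sum_congr rfl fun ε _ => ?_
  have h1 : Summable fun N => inner ℂ (embed (freeGen α₀ (-m) Φ))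
      (embed (VV α₀ (ε * q) N (N + n) Ψ)) := summable_inner (h ε n Ψ) _
  have h2 : Summable fun N => inner ℂ (embed Φ)
      (embed (VV α₀ (ε * q) N (N + n) (freeGen α₀ m Ψ))) := summable_inner (h ε n _) _
  rw [← h1.tsum_sub h2]
  refine tsum_congr fun N => ?_
  rw [isAdjTwo_freeGen, neg_neg, map_sub, inner_sub_right]

theorem inner_gen_zero (h : ModesSummable α₀ q) (lam : ℂ) {n : ℤ} (hn : n = 1 ∨ n = -1)
    (Φ Ψ : TwoFin) : inner ℂ (gen h (conj lam) 0 Φ) (gen h lam n Ψ) -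
      inner ℂ (gen h (conj lam) (-n) Φ) (gen h lam 0 Ψ) =
      -(n : ℂ) * inner ℂ (embed Φ) (gen h lam n Ψ) := by
  have hn0 : n ≠ 0 := by omega
  have h1 := inner_freeGen_productMode h 0 n Φ Ψ
  simp only [freeGen_zero_comp_VV, add_sub_cancel_left, map_smul, inner_smul_right, neg_zero] at h1
  have h2 : ∑ ε : ℤˣ, ∑' N : ℤ, ((N : ℂ) - ((N + n : ℤ) : ℂ)) *
      inner ℂ (embed Φ) (embed (VV α₀ (ε * q) N (N + n) Ψ)) =
      -(n : ℂ) * inner ℂ (embed Φ) (productMode h n Ψ) := by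
    rw [inner_productMode_right, Finset.mul_sum]
    refine Finset.sum_congr rfl fun ε _ => ?_
    rw [← tsum_mul_left]
    refine tsum_congr fun N => ?_
    push_cast
    ring
  rw [h2] at h1
  have h3 : inner ℂ (embed (freeGen α₀ 0 Φ)) (embed (freeGen α₀ n Ψ)) -
      inner ℂ (embed (freeGen α₀ (-n) Φ)) (embed (freeGen α₀ 0 Ψ)) =
      -(n : ℂ) * inner ℂ (embed Φ) (embed (freeGen α₀ n Ψ)) := by
    rw [isAdjTwo_freeGen α₀ 0, isAdjTwo_freeGen α₀ (-n), neg_zero, neg_neg,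
      freeGen_zero_comp α₀ hn, map_sub, inner_sub_right, map_smul, inner_smul_right]
    ring
  simp only [gen_zero, gen_of_ne_zero h _ hn0, gen_of_ne_zero h _ (neg_ne_zero.2 hn0),
    inner_add_left, inner_add_right, inner_smul_left, inner_smul_right, Complex.conj_conj]
  linear_combination h3 + lam * h1

/-- The mixed terms in the commutator of `𝔩₁` and `𝔩₋₁` cancel. -/
theorem inner_freeGen_productMode_swap (h : ModesSummable α₀ q) (Φ Ψ : TwoFin) :
    inner ℂ (embed (freeGen α₀ (-1) Φ)) (productMode h (-1) Ψ) -
      inner ℂ (productMode h 1 Φ) (embed (freeGen α₀ 1 Ψ)) =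
    inner ℂ (embed (freeGen α₀ 1 Φ)) (productMode h 1 Ψ) -
      inner ℂ (productMode h (-1) Φ) (embed (freeGen α₀ (-1) Ψ)) := by
  have := sesq_ext (F := sesq (embed ∘ₗ freeGen α₀ (-1)) (productMode h (-1)) -
      sesq (productMode h 1) (embed ∘ₗ freeGen α₀ 1))
    (G := sesq (embed ∘ₗ freeGen α₀ 1) (productMode h 1) -
      sesq (productMode h (-1)) (embed ∘ₗ freeGen α₀ (-1))) fun j ν μ j' ν' μ' => by
    simp only [LinearMap.sub_apply, sesq_apply, LinearMap.comp_apply]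
    have h1 := inner_freeGen_productMode h 1 (-1) (Finsupp.single j (ket ν ⊗ₜ ket μ))
      (Finsupp.single j' (ket ν' ⊗ₜ ket μ'))
    have h2 := inner_freeGen_productMode h (-1) 1 (Finsupp.single j (ket ν ⊗ₜ ket μ))
      (Finsupp.single j' (ket ν' ⊗ₜ ket μ'))
    rw [neg_neg] at h1 h2
    rw [h1, h2]
    refine Finset.sum_congr rfl fun ε _ => ?_
    set f : ℤ → ℂ := fun N => inner ℂ (embed (Finsupp.single j (ket ν ⊗ₜ ket μ)))
      (embed (VV α₀ (ε * q) N N (Finsupp.single j' (ket ν' ⊗ₜ ket μ')))) with hf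
    -- Conservation of energy leaves a single `N`, so the polynomial weights in `N` below cause no
    -- convergence problem.
    have hf0 : ∀ N : ℤ, N ≠ energy ν - energy ν' → f N = 0 := fun N hN => by
      simp only [hf, VV_single, inner_embed_single]
      rw [(hasEnergy_ket ν).inner_eq_zero ((hasEnergy_ket ν').V _ N) (by omega), zero_mul, ite_self]
    have hsum : ∀ g : ℤ → ℂ, Summable fun N => g N * f N := fun g =>
      summable_of_hasFiniteSupport ((Set.finite_singleton ((energy ν : ℤ) - energy ν')).subset
        fun N hN => by
          by_contra h
          exact hN (by beta_reduce; rw [hf0 N h, mul_zero]))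
    have hfN : ∀ N, inner ℂ (embed (Finsupp.single j (ket ν ⊗ₜ ket μ)))
      (embed (VV α₀ (ε * q) N N (Finsupp.single j' (ket ν' ⊗ₜ ket μ')))) = f N := fun _ => rfl
    obtain ⟨a, ha⟩ : ∃ a : ℂ, a = (((ε * q : ℤ) * α₀ : ℝ) : ℂ) := ⟨_, rfl⟩
    obtain ⟨b, hb⟩ : ∃ b : ℂ, b = ((j' * α₀ : ℝ) : ℂ) := ⟨_, rfl⟩
    have e1 : ∀ N : ℤ, inner ℂ (embed (Finsupp.single j (ket ν ⊗ₜ ket μ)))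
        (embed (freeGen α₀ 1 (VV α₀ (ε * q) N (N + -1) (Finsupp.single j' (ket ν' ⊗ₜ ket μ'))) -
          VV α₀ (ε * q) N (N + -1) (freeGen α₀ 1 (Finsupp.single j' (ket ν' ⊗ₜ ket μ'))))) =
        (((N - 1 : ℤ) : ℂ) + a ^ 2 + a * b) * f (N - 1) + ((N : ℂ) + a * b) * f N := by
      intro N
      rw [freeGen_one_comp_VV, ← ha, ← hb, add_assoc, add_sub_cancel_left, map_add, inner_add_right, map_smul,
        map_smul, inner_smul_right, inner_smul_right, neg_add_cancel_right, ← sub_eq_add_neg,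
        hfN, hfN]
      push_cast
      ring
    have e2 : ∀ N : ℤ, inner ℂ (embed (Finsupp.single j (ket ν ⊗ₜ ket μ)))
        (embed (freeGen α₀ (-1) (VV α₀ (ε * q) N (N + 1) (Finsupp.single j' (ket ν' ⊗ₜ ket μ'))) -
          VV α₀ (ε * q) N (N + 1) (freeGen α₀ (-1) (Finsupp.single j' (ket ν' ⊗ₜ ket μ'))))) =
        (((N + 1 : ℤ) : ℂ) + a * b) * f (N + 1) + ((N : ℂ) + a ^ 2 + a * b) * f N := by
      intro N
      rw [freeGen_neg_one_comp_VV, ← ha, ← hb, add_assoc, add_sub_cancel_left, map_add, inner_add_right,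
        map_smul, map_smul, inner_smul_right, inner_smul_right, add_sub_cancel_right,
        hfN, hfN]
      push_cast
      ring
    have hs1 := hsum fun N => (N : ℂ) + a ^ 2 + a * b
    have hs2 := hsum fun N => (N : ℂ) + a * b
    have hs1' : Summable fun N : ℤ => (((N - 1 : ℤ) : ℂ) + a ^ 2 + a * b) * f (N - 1) :=
      hs1.comp_injective (sub_left_injective (b := (1 : ℤ)))
    have hs2' : Summable fun N : ℤ => (((N + 1 : ℤ) : ℂ) + a * b) * f (N + 1) :=
      hs2.comp_injective (add_left_injective (1 : ℤ))
    have t1 : ∑' N : ℤ, (((N - 1 : ℤ) : ℂ) + a ^ 2 + a * b) * f (N - 1) = _ :=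
      (Equiv.subRight (1 : ℤ)).tsum_eq fun N : ℤ => ((N : ℂ) + a ^ 2 + a * b) * f N
    have t2 : ∑' N : ℤ, (((N + 1 : ℤ) : ℂ) + a * b) * f (N + 1) = _ :=
      (Equiv.addRight (1 : ℤ)).tsum_eq fun N : ℤ => ((N : ℂ) + a * b) * f N
    -- After the shifts by ±1 both sides are the sum of the same two series, with weights N + a² +
    -- ab and N + ab, in opposite order.
    rw [tsum_congr e1, tsum_congr e2, hs1'.tsum_add hs2, hs2'.tsum_add hs1, t1, t2, add_comm]
  exact congrArg (fun F : TwoFin →ₗ⋆[ℂ] TwoFin →ₗ[ℂ] ℂ => F Φ Ψ) this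

/-- The modes of the product field commute weakly. -/
theorem inner_productMode_comm (h : ModesSummable α₀ q)
    (hα : |(q : ℝ) * α₀| < 1 / Real.sqrt 2) (m : ℤ) (Φ Ψ : TwoFin) :
    inner ℂ (productMode h m Φ) (productMode h m Ψ) =
      inner ℂ (productMode h (-m) Φ) (productMode h (-m) Ψ) := by
  have := sesq_ext (F := sesq (productMode h m) (productMode h m))
    (G := sesq (productMode h (-m)) (productMode h (-m))) fun j ν μ j' ν' μ' => by
    simp only [sesq_apply]
    have h1 : ∀ n : ℤ, inner ℂ (productMode h n (Finsupp.single j (ket ν ⊗ₜ ket μ)))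
        (productMode h n (Finsupp.single j' (ket ν' ⊗ₜ ket μ'))) =
        ∑ ε₁ : ℤˣ, ∑ ε₂ : ℤˣ, if j + ε₁ * q = j' + ε₂ * q then
          ∑' N : ℤ, inner ℂ (embed0 (V ((ε₁ * q : ℤ) * α₀) N (ket ν)))
            (embed0 (V ((ε₂ * q : ℤ) * α₀) (N + (energy ν - energy ν')) (ket ν'))) *
          inner ℂ (embed0 (V ((ε₁ * q : ℤ) * α₀) (N + n) (ket μ)))
            (embed0 (V ((ε₂ * q : ℤ) * α₀) (N + n + (energy ν - energy ν')) (ket μ')))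
        else 0 := by
      intro n
      rw [inner_productMode_left]
      refine Finset.sum_congr rfl fun ε₁ _ => ?_
      simp only [inner_productMode_right, VV_single, inner_embed_single]
      obtain ⟨R, h₁, h₂, h₃, h₄⟩ :
          ∃ R, energy ν < R ∧ energy ν' < R ∧ energy μ < R ∧ energy μ' < R :=
        ⟨energy ν + energy ν' + energy μ + energy μ' + 1, by omega, by omega, by omega, by omega⟩
      have hs : ∀ ε₂ : ℤˣ, _ := fun ε₂ => (hasSum_inner_V_V (neg_half_lt hα ε₁ ε₂) ν ν' μ μ'
        h₁ h₂ h₃ h₄ (energy ν - energy ν') n).summable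
      have hN : ∀ (ε₂ : ℤˣ) (N : ℤ), (∑' N' : ℤ, if j + ε₁ * q = j' + ε₂ * q then
          inner ℂ (embed0 (V ((ε₁ * q : ℤ) * α₀) N (ket ν)))
            (embed0 (V ((ε₂ * q : ℤ) * α₀) N' (ket ν'))) *
          inner ℂ (embed0 (V ((ε₁ * q : ℤ) * α₀) (N + n) (ket μ)))
            (embed0 (V ((ε₂ * q : ℤ) * α₀) (N' + n) (ket μ'))) else 0) =
          if j + ε₁ * q = j' + ε₂ * q then
          inner ℂ (embed0 (V ((ε₁ * q : ℤ) * α₀) N (ket ν)))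
            (embed0 (V ((ε₂ * q : ℤ) * α₀) (N + (energy ν - energy ν')) (ket ν'))) *
          inner ℂ (embed0 (V ((ε₁ * q : ℤ) * α₀) (N + n) (ket μ)))
            (embed0 (V ((ε₂ * q : ℤ) * α₀) (N + n + (energy ν - energy ν')) (ket μ'))) else 0 := by
        -- Energy conservation in the first tensor factor determines `N'` from `N`, so the double
        -- series collapses.
        intro ε₂ N
        rw [tsum_eq_single (N + (energy ν - energy ν')), add_right_comm]
        intro N' hN'
        rw [((hasEnergy_ket ν).V _ N).inner_eq_zero ((hasEnergy_ket ν').V _ N') (by omega),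
          zero_mul, ite_self]
      simp only [hN]
      rw [Summable.tsum_finsetSum]
      · refine Finset.sum_congr rfl fun ε₂ _ => ?_
        split_ifs
        · rfl
        · exact tsum_zero
      · intro ε₂ _
        split_ifs
        · exact hs ε₂
        · exact summable_zero
    -- The exchange of the fields maps the signs (ε₁, ε₂) to (-ε₂, -ε₁). This preserves the
    -- condition on the sectors and needs both signs of the charge in the sum.
    rw [h1, h1, Finset.sum_comm, ← Equiv.sum_comp (Equiv.neg ℤˣ)]
    refine Finset.sum_congr rfl fun ε₁ _ => ?_
    rw [← Equiv.sum_comp (Equiv.neg ℤˣ)]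
    refine Finset.sum_congr rfl fun ε₂ _ => ?_
    have := tsum_inner_V_V_swap (neg_half_lt hα (-ε₂) (-ε₁)) ν ν' μ μ' (energy ν - energy ν') m
    simp only [Equiv.neg_apply, Units.val_neg, neg_mul, Int.cast_neg, neg_neg] at this ⊢
    by_cases hc : j + -(ε₂ * q) = j' + -(ε₁ * q)
    · rw [if_pos hc, if_pos (by omega), this]
    · rw [if_neg hc, if_neg (by omega)]
  exact congrArg (fun F : TwoFin →ₗ⋆[ℂ] TwoFin →ₗ[ℂ] ℂ => F Φ Ψ) this

/-- Sorted by powers of λ: order zero is the free relation, order one the cancellation of the mixed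
terms, order two locality. The conjugate coupling is conjugated again by the inner product, so
complex λ is allowed. -/
theorem inner_gen_one_neg_one (h : ModesSummable α₀ q)
    (hα : |(q : ℝ) * α₀| < 1 / Real.sqrt 2) (lam : ℂ)
    (Φ Ψ : TwoFin) : inner ℂ (gen h (conj lam) (-1) Φ) (gen h lam (-1) Ψ) -
      inner ℂ (gen h (conj lam) 1 Φ) (gen h lam 1 Ψ) =
      2 * inner ℂ (embed Φ) (gen h lam 0 Ψ) := by
  have h1 := inner_freeGen_productMode_swap h Φ Ψ
  have h2 := inner_productMode_comm h hα 1 Φ Ψ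
  have h3 : inner ℂ (embed (freeGen α₀ (-1) Φ)) (embed (freeGen α₀ (-1) Ψ)) -
      inner ℂ (embed (freeGen α₀ 1 Φ)) (embed (freeGen α₀ 1 Ψ)) =
      2 * inner ℂ (embed Φ) (embed (freeGen α₀ 0 Ψ)) := by
    rw [isAdjTwo_freeGen α₀ (-1), isAdjTwo_freeGen α₀ 1, neg_neg, freeGen_one_comp_neg_one,
      map_add, inner_add_right, map_smul, inner_smul_right]
    ring
  simp only [gen_zero, gen_of_ne_zero h _ one_ne_zero,
    gen_of_ne_zero h _ (show (-1 : ℤ) ≠ 0 by decide),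
    inner_add_left, inner_add_right, inner_smul_left, inner_smul_right, Complex.conj_conj]
  linear_combination h3 + lam * h1 - lam * lam * h2

end ChargedU1

end

/-! ### The Lorentz relations -/

theorem mainTheorem3 (α₀ : ℝ) (hα₀ : α₀ ≠ 0) (hα₀' : |α₀| ≤ 1)
    (q : ℤ) (hα : |(q : ℝ) * α₀| < 1 / Real.sqrt 2) (lam : ℂ) :
    Dense (ChargedU1.finDomain : Set ChargedU1.TwoHil) ∧
    (∀ n j : ℤ, {p : ℝ × ℤˣ |
      ChargedU1.modeTerm α₀ q n p ∘ₗ Finsupp.lsingle j ≠ 0}.Countable) ∧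
    (∀ m n : ℤ, m ∈ ({-1, 0, 1} : Set ℤ) → n ∈ ({-1, 0, 1} : Set ℤ) →
      ChargedU1.WeakCommutator ChargedU1.finDomain
        (ChargedU1.lorentzGen α₀ q lam m) (ChargedU1.lorentzGen α₀ q lam n)
        (((m : ℂ) - (n : ℂ)) • ChargedU1.lorentzGen α₀ q lam (m + n))) := by
  refine ⟨ChargedU1.dense_finDomain, ChargedU1.countable_modeTerm_ne_zero α₀ q,
    fun m n hm hn => ?_⟩
  have h := ChargedU1.modesSummable hα
  refine ChargedU1.weakCommutator_of_inner_gen h lam m n fun Φ Ψ => ?_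
  have h1 := ChargedU1.inner_gen_zero h lam (Or.inl rfl) Φ Ψ
  have h2 := ChargedU1.inner_gen_zero h lam (Or.inr rfl) Φ Ψ
  have h3 := ChargedU1.inner_gen_one_neg_one h hα lam Φ Ψ
  simp only [Int.cast_one, Int.cast_neg, neg_neg] at h1 h2
  simp only [Set.mem_insert_iff, Set.mem_singleton_iff] at hm hn
  -- The diagonal cases are trivial, and by antisymmetry the other six are the three relations `h1`,
  -- `h2`, `h3` up to sign.
  rcases hm with rfl | rfl | rfl <;> rcases hn with rfl | rfl | rfl <;>
    norm_num <;> first | linear_combination h1 | linear_combination h2 | linear_combination h3 |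
      linear_combination -h1 | linear_combination -h2 | linear_combination -h3
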